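/- There exist a closed connected $C^\infty$ $4$-manifold $M$, a $C^\infty$ foliation $\mathcal F$ of $M$ of dimension $2$ and codimension $2$, and a finite transverse invariant measure $\nu$ of $\mathcal F$ such that $\mathcal F$ is ergodic and Følner with respect to $\nu$, but not amenable with respect to $\nu$. Here the terms have the following meaning. Let $\{(U_i,\phi_i)\}_{i\in I}$ be a finite foliated atlas of $(M,\mathcal F)$, where $\phi_i$ maps $U_i$ onto a product $P_i\times T_i$ of open discs of $\mathbb R^2$, each $\overline U_i$ is contained in some foliated chart, and each plaque (fibre of the projection $\pi_i:U_i\to T_i$) of $U_i$ meets at most one plaque of $U_j$. Let $T=\coprod_i T_i$ be the associated total transversal, let $\mathcal R$ be the equivalence relation on $T$ of lying in the same leaf, and let $\gamma_{ij}:\pi_i(U_i\cap U_j)\to\pi_j(U_i\cap U_j)$ be the holonomy maps, determined by $\pi_j=\gamma_{ij}\circ\pi_i$ on $U_i\cap U_j$. * $\nu$ is a finite transverse invariant measure if it is a finite Borel measure on $T$ with $\nu(\gamma_{ij}(B))=\nu(B)$ for all $i,j$ and every Borel set $B\subset\pi_i(U_i\cap U_j)$. * $\mathcal F$ is ergodic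 with respect to $\nu$ if every $\mathcal R$-saturated Borel subset of $T$ is $\nu$-null or has $\nu$-null complement. * $\mathcal F$ is Følner with respect to $\nu$ if for $\nu$-almost every $y\in T$ there are finite nonempty sets $A_k\subset\mathcal R[y]$ with $|\partial A_k|/|A_k|\to0$, where $\mathcal R[y]$ is the graph whose edges join $z$ and $\gamma_{ij}(z)$, and $\partial A$ is the set of points of $A$ that are end points of an edge with exactly one end point in $A$. * $\mathcal F$ is amenable with respect to $\nu$ if for $\nu$-almost every $y\in T$ there is a mean $m_y$ on $\mathcal R[y]$ (a positive linear functional on $\ell^\infty(\mathcal R[y])$ with $m_y(1)=1$) such that $m_y=m_z$ for all $z\in\mathcal R[y]$, and such that $y\mapsto m_y(f(y,\cdot))$ is $\nu$-measurable for every bounded measurable function $f$ on the graph of $\mathcal R$. The assertion is that $M$, $\mathcal F$, such an atlas and such a measure $\nu$ exist. -/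

import Mathlib

open Set Filter Topology MeasureTheory
open scoped Manifold ContDiff

/-- The pair of Euclidean spaces in which foliated charts take their values: the first factor is
the leaf direction, the second one is the transverse direction. -/
abbrev FoliatedModel (d q : ℕ) : Type :=
  EuclideanSpace ℝ (Fin d) × EuclideanSpace ℝ (Fin q)

section Foliations

variable {M : Type*} [TopologicalSpace M]

/-- The change of charts from `e` to `e'` has locally the form `(x, y) ↦ (ψ (x, y), γ y)`. -/
def PlaqueCompatible {d q : ℕ} (e e' : OpenPartialHomeomorph M (FoliatedModel d q)) : Prop :=
  ∀ p ∈ e.source ∩ e'.source,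
    ∃ γ : EuclideanSpace ℝ (Fin q) → EuclideanSpace ℝ (Fin q),
      ∀ᶠ z in 𝓝 p, (e' z).2 = γ (e z).2

/-- `e` is a `C^∞` diffeomorphism from an open subset of the `n`-manifold `M` onto the product of
an open disc of `ℝ^d` and an open disc of `ℝ^q`. -/
def IsSmoothBoxChart (n : ℕ) {d q : ℕ} [ChartedSpace (EuclideanSpace ℝ (Fin n)) M]
    (e : OpenPartialHomeomorph M (FoliatedModel d q)) : Prop :=
  ContMDiffOn (𝓡 n) 𝓘(ℝ, FoliatedModel d q) ∞ e e.source ∧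
  ContMDiffOn 𝓘(ℝ, FoliatedModel d q) (𝓡 n) ∞ e.symm e.target ∧
  ∃ (a : EuclideanSpace ℝ (Fin d)) (r : ℝ) (b : EuclideanSpace ℝ (Fin q)) (s : ℝ),
    0 < r ∧ 0 < s ∧ e.target = Metric.ball a r ×ˢ Metric.ball b s

variable (M) in
/-- A `C^∞` foliation of dimension `d` and codimension `q` of the `n`-manifold `M`, given by its
maximal foliated atlas. -/
structure Foliation (n d q : ℕ) [ChartedSpace (EuclideanSpace ℝ (Fin n)) M] where
  charts : Set (OpenPartialHomeomorph M (FoliatedModel d q))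
  smooth : ∀ e ∈ charts, IsSmoothBoxChart n e
  cover : ∀ p : M, ∃ e ∈ charts, p ∈ e.source
  compatible : ∀ e ∈ charts, ∀ e' ∈ charts, PlaqueCompatible e e'
  maximal : ∀ e : OpenPartialHomeomorph M (FoliatedModel d q), IsSmoothBoxChart n e →
    (∀ e' ∈ charts, PlaqueCompatible e e' ∧ PlaqueCompatible e' e) → e ∈ charts

namespace Foliation

variable {n d q : ℕ} [ChartedSpace (EuclideanSpace ℝ (Fin n)) M]

/-- Two points lie in the same leaf if and only if they are joined by a finite chain of plaques,
the plaques being the fibres of the transverse projections of the foliated charts. -/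
def leafSetoid (F : Foliation M n d q) : Setoid M :=
  Relation.EqvGen.setoid fun p p' =>
    ∃ e ∈ F.charts, p ∈ e.source ∧ p' ∈ e.source ∧ (e p).2 = (e p').2

/-- A finite foliated atlas such that the closure of every chart domain is compact and contained
in some foliated chart, and every plaque of a chart meets at most one plaque of any other one. -/
structure RegularAtlas (F : Foliation M n d q) where
  size : ℕ
  chart : Fin size → OpenPartialHomeomorph M (FoliatedModel d q)
  mem_charts : ∀ i, chart i ∈ F.charts
  cover : ∀ p : M, ∃ i, p ∈ (chart i).source
  closure_compact : ∀ i, IsCompact (closure (chart i).source)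
  closure_subset : ∀ i, ∃ e ∈ F.charts, closure (chart i).source ⊆ e.source
  plaque_unique : ∀ i j, ∀ p ∈ (chart i).source ∩ (chart j).source,
    ∀ p' ∈ (chart i).source ∩ (chart j).source,
      (chart i p).2 = (chart i p').2 → (chart j p).2 = (chart j p').2

namespace RegularAtlas

variable {F : Foliation M n d q}

/-- The local transversal `T_i`, an open disc of `ℝ^q`. -/
abbrev LocalTransversal (A : F.RegularAtlas) (i : Fin A.size) : Type :=
  ↥(Prod.snd '' (A.chart i).target)

/-- The total transversal `T`, the disjoint union of the local transversals. -/
abbrev Transversal (A : F.RegularAtlas) : Type :=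
  Σ i : Fin A.size, A.LocalTransversal i

/-- The plaque through a point of the total transversal. -/
def plaque (A : F.RegularAtlas) (s : A.Transversal) : Set M :=
  {p | p ∈ (A.chart s.1).source ∧ (A.chart s.1 p).2 = s.2}

theorem plaque_nonempty (A : F.RegularAtlas) (s : A.Transversal) : (A.plaque s).Nonempty := by
  obtain ⟨i, y, ⟨v, hv, rfl⟩⟩ := s
  exact ⟨(A.chart i).symm v, (A.chart i).map_target hv, by simp [(A.chart i).right_inv hv]⟩

theorem leaf_of_mem_plaque (A : F.RegularAtlas) {s : A.Transversal} {p p' : M}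
    (hp : p ∈ A.plaque s) (hp' : p' ∈ A.plaque s) : F.leafSetoid p p' :=
  Relation.EqvGen.rel _ _ ⟨_, A.mem_charts s.1, hp.1, hp'.1, hp.2.trans hp'.2.symm⟩

/-- The equivalence relation induced by the foliation on the total transversal: two points are
equivalent if they belong to (their plaques lie in) the same leaf. -/
def rel (A : F.RegularAtlas) : Setoid A.Transversal where
  r s t := ∃ p ∈ A.plaque s, ∃ p' ∈ A.plaque t, F.leafSetoid p p'
  iseqv :=
    { refl := fun s => by
        obtain ⟨p, hp⟩ := A.plaque_nonempty s
        exact ⟨p, hp, p, hp, F.leafSetoid.refl p⟩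
      symm := by
        rintro s t ⟨p, hp, p', hp', h⟩
        exact ⟨p', hp', p, hp, F.leafSetoid.symm h⟩
      trans := by
        rintro s t u ⟨p, hp, p', hp', h⟩ ⟨x, hx, x', hx', h'⟩
        exact ⟨p, hp, x', hx',
          F.leafSetoid.trans (F.leafSetoid.trans h (A.leaf_of_mem_plaque hp' hx)) h'⟩ }

/-- Two points of the total transversal are joined by a generator `γ_ij` of the holonomy
pseudogroup: `Adj ⟨i, y⟩ ⟨j, z⟩` says that `y` is in the domain of `γ_ij` and `γ_ij y = z`. -/
def Adj (A : F.RegularAtlas) (s t : A.Transversal) : Prop :=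
  (A.plaque s ∩ A.plaque t).Nonempty

/-- A measure on the total transversal is a transverse invariant measure if it is preserved by
all the generators `γ_ij` of the holonomy pseudogroup: `ν (γ_ij B) = ν B` for every Borel set `B`
contained in the domain of `γ_ij`. -/
def IsInvariant (A : F.RegularAtlas) (ν : Measure A.Transversal) : Prop :=
  ∀ (i j : Fin A.size) (B : Set (A.LocalTransversal i)), MeasurableSet B →
    (∀ y ∈ B, ∃ z, A.Adj ⟨i, y⟩ ⟨j, z⟩) →
      ν (Sigma.mk j '' {z | ∃ y ∈ B, A.Adj ⟨i, y⟩ ⟨j, z⟩}) = ν (Sigma.mk i '' B)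

end RegularAtlas

end Foliation

end Foliations

section EquivalenceRelations

variable {T : Type*}

/-- Every measurable saturated set has zero or full measure. -/
def Setoid.IsErgodicFor [MeasurableSpace T] (r : Setoid T) (ν : Measure T) : Prop :=
  ∀ B : Set T, MeasurableSet B → (∀ y z, r y z → y ∈ B → z ∈ B) → ν B = 0 ∨ ν Bᶜ = 0

/-- `m` is a mean on `c`: a positive normalized linear functional on bounded functions. A
functional on `ℓ^∞(c)` is regarded as a functional on `ℓ^∞(T)` that depends only on the
restriction of functions to `c`. -/
def IsMeanOn (c : Set T) (m : lp (fun _ : T => ℝ) ⊤ →ₗ[ℝ] ℝ) : Prop :=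
  (∀ f : lp (fun _ : T => ℝ) ⊤, (∀ z, 0 ≤ f z) → 0 ≤ m f) ∧
  m 1 = 1 ∧
  ∀ f : lp (fun _ : T => ℝ) ⊤, (∀ z ∈ c, f z = 0) → m f = 0

/-- Amenability of an equivalence relation with respect to a measure: there are means `m y` on the
classes of almost all points `y`, which are the same at all points of a class, and such that
`y ↦ m y (f (y, ·))` is measurable for every bounded measurable function `f`. -/
def Setoid.IsAmenableFor [MeasurableSpace T] (r : Setoid T) (ν : Measure T) : Prop :=
  ∃ m : T → (lp (fun _ : T => ℝ) ⊤ →ₗ[ℝ] ℝ),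
    (∀ᵐ y ∂ν, IsMeanOn {z | r y z} (m y) ∧ ∀ z, r y z → m z = m y) ∧
    ∀ f : T → lp (fun _ : T => ℝ) ⊤, Measurable (fun p : T × T => f p.1 p.2) →
      (∃ C : ℝ, ∀ y, ‖f y‖ ≤ C) → AEMeasurable (fun y => m y (f y)) ν

/-- The boundary of a finite set `A` of vertices of a graph: the end points in `A` of the edges
with exactly one end point in `A`. -/
def graphBoundary (adj : T → T → Prop) (A : Finset T) : Set T :=
  {a | a ∈ A ∧ ∃ b, b ∉ A ∧ adj a b}

/-- A set of vertices of a graph (here: an equivalence class) is Følner if it contains finite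
nonempty subsets with arbitrarily small isoperimetric ratio. -/
def IsFolnerSet (adj : T → T → Prop) (c : Set T) : Prop :=
  ∃ A : ℕ → Finset T, (∀ k, (A k).Nonempty ∧ ∀ a ∈ A k, a ∈ c) ∧
    Tendsto (fun k => ((graphBoundary adj (A k)).ncard : ℝ) / ((A k).card : ℝ)) atTop (𝓝 0)

end EquivalenceRelations

namespace Foliation.RegularAtlas

variable {M : Type*} [TopologicalSpace M] {n d q : ℕ}
  [ChartedSpace (EuclideanSpace ℝ (Fin n)) M] {F : Foliation M n d q}

/-- The foliation is ergodic with respect to the transverse measure `ν`. -/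
def IsErgodic (A : F.RegularAtlas) (ν : Measure A.Transversal) : Prop :=
  A.rel.IsErgodicFor ν

/-- The foliation is amenable with respect to the transverse measure `ν`. -/
def IsAmenable (A : F.RegularAtlas) (ν : Measure A.Transversal) : Prop :=
  A.rel.IsAmenableFor ν

/-- The foliation is Følner with respect to the transverse invariant measure `ν`: almost every
equivalence class is Følner, for the graph given by the generators of the holonomy pseudogroup. -/
def IsFolner (A : F.RegularAtlas) (ν : Measure A.Transversal) : Prop :=
  ∀ᵐ y ∂ν, IsFolnerSet A.Adj {z | A.rel y z}

end Foliation.RegularAtlas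

/-!
The manifold is a bundle of tori over the closed surface of genus `2`, foliated by the leaves of a
flat connection. The surface is the double of a pair of pants, a round disc without two smaller
discs: two copies of the planar region are glued by the inversions in the three boundary circles.
Crossing the `j`-th circle acts on the torus by a diffeomorphism `f j`, with `f 0 = id`, so the
total space `Pants.Suspension f` is a quotient of two copies of `region × torus` and is covered by
finitely many small boxes (`regularAtlas`). The transversal maps onto the torus (`toTorus`), the
holonomy maps are given by the `f j` and their inverses (`exists_adj_holonomy`), and two points lie
in the same leaf if and only if their images lie in the same orbit of the group generated by the
`f j` (`rel_iff`). Pulling back Haar measure gives a finite transverse measure, invariant since the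
`f j` preserve Haar measure.

Besides the identity, the monodromy consists of the hyperbolic automorphism `[1 2; 2 5]`, which is
the product of the elementary matrices `[1 0; 2 1]` and `[1 2; 0 1]`, and of the shear `[1 2; 0 1]`,
modified so that it is the identity near the circle `x.2 = 0` through the fixed point `0` of the
hyperbolic automorphism.

* Ergodicity: the hyperbolic automorphism alone is ergodic (`hyperbolic_ergodic`), since the Fourier
  coefficients of an invariant function are constant along infinite orbits.
* Følner property: by ergodicity almost every orbit meets the set of points whose first `N` iterates
  under the hyperbolic automorphism stay in the strip where the modified shear is the identity
  (`ae_exists_mem_quietSet`). The generators lead out of such a segment of `N` points only at its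
  two ends (`holonomy_mem_segment`).
* Non-amenability: the two elementary matrices generate a free group acting freely almost everywhere
  (`sanovAction_free`). Outside a strip of measure `1 / 4`, both of them move points within the
  orbits of the monodromy group, so they provide a forest in the orbit relation with
  `3 / 4 + 3 / 4` edges per point on average. In an amenable relation a forest has at most one edge
  per point on average (`PartialForest.sum_measureReal_le_one`): every edge splits its component
  into two sides whose means sum up to `1`, and the edges at a point have disjoint far sides.
-/

/-! ### A pair of pants in the plane -/

/-- The Euclidean plane. -/
abbrev Plane : Type := EuclideanSpace ℝ (Fin 2)

namespace Pants

/-- The centres of the three circles across which two copies of the pair of pants are glued. The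
first circle is the outer boundary, the second one is concentric to it. -/
def center : Fin 3 → Plane := ![0, 0, !₂[5, 0]]

/-- The radii of the three gluing circles. -/
def radius : Fin 3 → ℝ := ![9, 1, 1]

/-- The inversion in the `j`-th gluing circle. -/
noncomputable def reflect (j : Fin 3) (z : Plane) : Plane :=
  EuclideanGeometry.inversion (center j) (radius j) z

/-- The open pair of pants: a disc without two closed discs. It is slightly larger than the
compact one bounded by the gluing circles. -/
def region : Set Plane :=
  {z | dist z (center 0) < 10 ∧ 1 / 2 < dist z (center 1) ∧ 1 / 2 < dist z (center 2)}

/-- The compact pair of pants bounded by the gluing circles. -/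
def core : Set Plane :=
  {z | dist z (center 0) ≤ 9 ∧ 1 ≤ dist z (center 1) ∧ 1 ≤ dist z (center 2)}

theorem isOpen_region : IsOpen region := by
  have h : ∀ c : Plane, Continuous fun z : Plane => dist z c := fun c => by fun_prop
  exact (isOpen_lt (h _) continuous_const).inter
    ((isOpen_lt continuous_const (h _)).inter (isOpen_lt continuous_const (h _)))

theorem isCompact_core : IsCompact core := by
  refine (isCompact_closedBall (center 0) 9).of_isClosed_subset ?_ (fun z hz => hz.1)
  have h : ∀ c : Plane, Continuous fun z : Plane => dist z c := fun c => by fun_prop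
  exact (isClosed_le (h _) continuous_const).inter
    ((isClosed_le continuous_const (h _)).inter (isClosed_le continuous_const (h _)))

theorem core_subset_region : core ⊆ region := fun z hz =>
  ⟨by linarith [hz.1], by linarith [hz.2.1], by linarith [hz.2.2]⟩

theorem radius_pos (j : Fin 3) : 0 < radius j := by
  fin_cases j <;> simp [radius]

theorem dist_center_zero_two : dist (center 0) (center 2) = 5 := by
  simp [center, EuclideanSpace.dist_eq]

theorem reflect_reflect (j : Fin 3) (z : Plane) : reflect j (reflect j z) = z :=
  EuclideanGeometry.inversion_inversion _ (radius_pos j).ne' z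

theorem dist_reflect (j : Fin 3) (z : Plane) :
    dist (reflect j z) (center j) = radius j ^ 2 / dist z (center j) :=
  EuclideanGeometry.dist_inversion_center _ _ _

theorem ne_center {z : Plane} (hz : z ∈ region) (j : Fin 3) : z ≠ center j := by
  rintro rfl
  fin_cases j
  · have := hz.2.1; simp [center] at this; linarith
  · have := hz.2.1; simp at this; linarith
  · have := hz.2.2; simp at this; linarith

theorem contDiffAt_reflect {z : Plane} (hz : z ∈ region) (j : Fin 3) :
    ContDiffAt ℝ ∞ (reflect j) z :=
  ContDiffAt.inversion contDiffAt_const contDiffAt_const contDiffAt_id (ne_center hz j)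

theorem dist_center_of_reflect_mem {z : Plane} (hz : z ∈ region) {j : Fin 3}
    (hj : reflect j z ∈ region) :
    (j = 0 → 81 / 10 < dist z (center 0)) ∧ (j = 1 → dist z (center 1) < 2) ∧
      (j = 2 → dist z (center 2) < 2) := by
  have hp : 0 < dist z (center j) := dist_pos.2 (ne_center hz j)
  have h := dist_reflect j z
  refine ⟨?_, ?_, ?_⟩ <;> rintro rfl
  · have := hj.1
    rw [h, div_lt_iff₀ hp] at this
    simp only [radius, Matrix.cons_val_zero] at this
    linarith
  · have := hj.2.1
    rw [h, lt_div_iff₀ hp] at this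
    simp only [radius, Matrix.cons_val_one, Matrix.cons_val_zero] at this
    linarith
  · have := hj.2.2
    rw [h, lt_div_iff₀ hp] at this
    simp only [radius, Matrix.cons_val] at this
    linarith

/-- The collars of different gluing circles are at distance at least `1` from each other. -/
theorem reflect_index_unique {z z' : Plane} (hz : z ∈ region) (hz' : z' ∈ region)
    (hd : dist z z' < 1) {j k : Fin 3} (hj : reflect j z ∈ region) (hk : reflect k z' ∈ region) :
    j = k := by
  have h1 := dist_center_of_reflect_mem hz hj
  have h2 := dist_center_of_reflect_mem hz' hk
  have key : ∀ u v : Plane, dist u v < 1 → dist u (center 2) < 2 →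
      3 < dist u (center 0) ∧ dist v (center 0) < 8 := fun u v huv hu => by
    have h3 := dist_triangle_left (center 0) (center 2) u
    have h4 := dist_triangle u (center 2) (center 0)
    have h5 := dist_triangle_left v (center 0) u
    rw [dist_comm (center 2) (center 0)] at h4
    rw [dist_center_zero_two] at h3 h4
    exact ⟨by linarith, by linarith⟩
  have h5 := key z z' hd
  have h6 := key z' z (by rwa [dist_comm])
  have h7 := dist_triangle z z' (center 0)
  have h8 := dist_triangle_left z' (center 0) z
  have h9 : ∀ u, dist u (center 1) = dist u (center 0) := fun _ => rfl
  simp only [h9] at h1 h2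
  clear key h9
  fin_cases j <;> fin_cases k <;> simp at h1 h2 ⊢ <;> first
    | linarith
    | linarith [h5 h1]
    | linarith [h6 h2]

/-- Every point outside the compact pair of pants is moved into it by one of the inversions. -/
theorem exists_reflect_mem_core {z : Plane} (hz : z ∈ region) (hz' : z ∉ core) :
    ∃ j, reflect j z ∈ core := by
  have h02 := dist_center_zero_two
  have hcore : ∀ u, dist u (center 0) ≤ 9 → 1 ≤ dist u (center 0) → 1 ≤ dist u (center 2) →
      u ∈ core := fun u h1 h2 h3 => ⟨h1, h2, h3⟩
  by_cases h0 : 9 < dist z (center 0)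
  · refine ⟨0, ?_⟩
    have h := dist_reflect 0 z
    have hp : 0 < dist z (center 0) := by linarith
    simp only [radius, Matrix.cons_val_zero] at h
    have ha : dist (reflect 0 z) (center 0) ≤ 9 := by
      rw [h, div_le_iff₀ hp]; linarith
    have hb : 81 / 10 ≤ dist (reflect 0 z) (center 0) := by
      rw [h, le_div_iff₀ hp]; linarith [hz.1]
    have := dist_triangle (reflect 0 z) (center 2) (center 0)
    rw [dist_comm (center 2)] at this
    exact hcore _ ha (by linarith) (by linarith)
  by_cases h1 : dist z (center 1) < 1
  · refine ⟨1, ?_⟩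
    have h := dist_reflect 1 z
    have hp : 0 < dist z (center 1) := by linarith [hz.2.1]
    simp only [radius, Matrix.cons_val_one, Matrix.cons_val_zero] at h
    have ha : dist (reflect 1 z) (center 1) ≤ 2 := by
      rw [h, div_le_iff₀ hp]; linarith [hz.2.1]
    have hb : 1 ≤ dist (reflect 1 z) (center 1) := by
      rw [h, le_div_iff₀ hp]; linarith
    have h01 : dist (reflect 1 z) (center 1) = dist (reflect 1 z) (center 0) := rfl
    have := dist_triangle_right (center 0) (center 2) (reflect 1 z)
    rw [dist_comm (center 0) (reflect 1 z), dist_comm (center 2) (reflect 1 z)] at this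
    exact hcore _ (by linarith) (by linarith) (by linarith)
  · have h2 : dist z (center 2) < 1 := by
      by_contra h2
      exact hz' ⟨not_lt.1 h0, not_lt.1 h1, not_lt.1 h2⟩
    refine ⟨2, ?_⟩
    have h := dist_reflect 2 z
    have hp : 0 < dist z (center 2) := by linarith [hz.2.2]
    simp only [radius, Matrix.cons_val] at h
    have ha : dist (reflect 2 z) (center 2) ≤ 2 := by
      rw [h, div_le_iff₀ hp]; linarith [hz.2.2]
    have hb : 1 ≤ dist (reflect 2 z) (center 2) := by
      rw [h, le_div_iff₀ hp]; linarith
    have := dist_triangle_right (center 0) (center 2) (reflect 2 z)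
    rw [dist_comm (center 0) (reflect 2 z), dist_comm (center 2) (reflect 2 z)] at this
    have h' := dist_triangle (reflect 2 z) (center 2) (center 0)
    rw [dist_comm (center 2) (center 0)] at h'
    exact hcore _ (by linarith) (by linarith) (by linarith)

theorem mem_region_iff (z : Plane) : z ∈ region ↔
    z 0 ^ 2 + z 1 ^ 2 < 100 ∧ 1 / 4 < z 0 ^ 2 + z 1 ^ 2 ∧ 1 / 4 < (z 0 - 5) ^ 2 + z 1 ^ 2 := by
  have e1 : (1 / 2 : ℝ) = √(1 / 4) := by
    rw [eq_comm, Real.sqrt_eq_iff_mul_self_eq] <;> norm_num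
  have e2 : (10 : ℝ) = √100 := by
    rw [eq_comm, Real.sqrt_eq_iff_mul_self_eq] <;> norm_num
  simp only [region, mem_ofPred_eq, EuclideanSpace.dist_eq, Fin.sum_univ_two, Real.dist_eq, sq_abs]
  rw [e1, e2, Real.sqrt_lt_sqrt_iff (by positivity), Real.sqrt_lt_sqrt_iff (by positivity),
    Real.sqrt_lt_sqrt_iff (by positivity)]
  simp [center]

theorem segment_coord {x y z : Plane} (h : z ∈ segment ℝ x y) :
    ∃ t : ℝ, 0 ≤ t ∧ t ≤ 1 ∧ ∀ i, z i = (1 - t) * x i + t * y i := by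
  obtain ⟨a, b, ha, hb, hab, rfl⟩ := h
  refine ⟨b, hb, by linarith, fun i => ?_⟩
  simp [← hab]

theorem joinedIn_region_of_forall {x y : Plane}
    (h : ∀ t : ℝ, 0 ≤ t → t ≤ 1 → ∀ z : Plane, (∀ i, z i = (1 - t) * x i + t * y i) →
      z ∈ region) : JoinedIn region x y :=
  JoinedIn.of_segment_subset fun z hz => by
    obtain ⟨t, h0, h1, hz⟩ := segment_coord hz
    exact h t h0 h1 z hz

/-- A half-plane `c < a * u + b * v` disjoint from the two inner discs meets the pair of pants in a
convex set. -/
theorem joinedIn_of_halfplane {a b c : ℝ}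
    (h : ∀ u v : ℝ, c < a * u + b * v → 1 / 4 < u ^ 2 + v ^ 2 ∧ 1 / 4 < (u - 5) ^ 2 + v ^ 2)
    {x y : Plane} (hx : x 0 ^ 2 + x 1 ^ 2 < 100) (hy : y 0 ^ 2 + y 1 ^ 2 < 100)
    (hx' : c < a * x 0 + b * x 1) (hy' : c < a * y 0 + b * y 1) : JoinedIn region x y := by
  refine joinedIn_region_of_forall fun t h0 h1 z hz => ?_
  rw [mem_region_iff]
  refine ⟨?_, h _ _ ?_⟩
  · rw [hz 0, hz 1]
    have h2 : 0 ≤ t * (1 - t) * ((x 0 - y 0) ^ 2 + (x 1 - y 1) ^ 2) := by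
      have : 0 ≤ 1 - t := by linarith
      positivity
    rcases eq_or_lt_of_le h0 with rfl | h0
    · simpa using hx
    · nlinarith [mul_pos h0 (sub_pos.2 hy), mul_nonneg (sub_nonneg.2 h1) (sub_pos.2 hx).le]
  · rw [hz 0, hz 1]
    rcases eq_or_lt_of_le h0 with rfl | h0
    · simpa using hx'
    · nlinarith [mul_pos h0 (sub_pos.2 hy'), mul_nonneg (sub_nonneg.2 h1) (sub_pos.2 hx').le]

theorem joinedIn_upper {x y : Plane} (hx : x 0 ^ 2 + x 1 ^ 2 < 100) (hy : y 0 ^ 2 + y 1 ^ 2 < 100)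
    (hx' : 1 / 2 < x 1) (hy' : 1 / 2 < y 1) : JoinedIn region x y :=
  joinedIn_of_halfplane (a := 0) (b := 1) (c := 1 / 2)
    (fun u v h => ⟨by nlinarith [sq_nonneg u], by nlinarith [sq_nonneg (u - 5)]⟩) hx hy
    (by linarith) (by linarith)

theorem joinedIn_lower {x y : Plane} (hx : x 0 ^ 2 + x 1 ^ 2 < 100) (hy : y 0 ^ 2 + y 1 ^ 2 < 100)
    (hx' : x 1 < -1 / 2) (hy' : y 1 < -1 / 2) : JoinedIn region x y :=
  joinedIn_of_halfplane (a := 0) (b := -1) (c := 1 / 2)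
    (fun u v h => ⟨by nlinarith [sq_nonneg u], by nlinarith [sq_nonneg (u - 5)]⟩) hx hy
    (by linarith) (by linarith)

theorem joinedIn_right {x y : Plane} (hx : x 0 ^ 2 + x 1 ^ 2 < 100) (hy : y 0 ^ 2 + y 1 ^ 2 < 100)
    (hx' : 11 / 2 < x 0) (hy' : 11 / 2 < y 0) : JoinedIn region x y :=
  joinedIn_of_halfplane (a := 1) (b := 0) (c := 11 / 2)
    (fun u v h => ⟨by nlinarith [sq_nonneg v], by nlinarith [sq_nonneg v]⟩) hx hy
    (by linarith) (by linarith)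

theorem joinedIn_left {x y : Plane} (hx : x 0 ^ 2 + x 1 ^ 2 < 100) (hy : y 0 ^ 2 + y 1 ^ 2 < 100)
    (hx' : x 0 < -1 / 2) (hy' : y 0 < -1 / 2) : JoinedIn region x y :=
  joinedIn_of_halfplane (a := -1) (b := 0) (c := 1 / 2)
    (fun u v h => ⟨by nlinarith [sq_nonneg v], by nlinarith [sq_nonneg v]⟩) hx hy
    (by linarith) (by linarith)

/-- Four half-planes disjoint from the two inner discs cover everything but the rectangle spanned by
these discs, whose points are first moved vertically, away from the horizontal axis. -/
theorem joinedIn_top {z : Plane} (hz : z ∈ region) : JoinedIn region z !₂[6, 1] := by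
  have hz' := (mem_region_iff z).1 hz
  have hR : ∀ {x : Plane}, x 0 ^ 2 + x 1 ^ 2 < 100 → 11 / 2 < x 0 → JoinedIn region x !₂[6, 1] :=
    fun h h' => joinedIn_right h (by norm_num) h' (by norm_num)
  have hU : ∀ {x : Plane}, x 0 ^ 2 + x 1 ^ 2 < 100 → 1 / 2 < x 1 → JoinedIn region x !₂[6, 1] :=
    fun h h' => joinedIn_upper h (by norm_num) h' (by norm_num)
  have hL : ∀ {x : Plane}, x 0 ^ 2 + x 1 ^ 2 < 100 → x 1 < -1 / 2 → JoinedIn region x !₂[6, 1] :=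
    fun h h' => (joinedIn_lower h (y := !₂[6, -1]) (by norm_num) h' (by norm_num)).trans
      (hR (by norm_num) (by norm_num))
  rcases lt_or_ge (11 / 2) (z 0) with h | h
  · exact hR hz'.1 h
  rcases lt_or_ge (z 0) (-1 / 2) with h' | h'
  · exact (joinedIn_left hz'.1 (y := !₂[-1, 1]) (by norm_num) h' (by norm_num)).trans
      (hU (by norm_num) (by norm_num))
  rcases lt_or_ge (1 / 2) (z 1) with hu | hu
  · exact hU hz'.1 hu
  rcases lt_or_ge (z 1) (-1 / 2) with hl | hl
  · exact hL hz'.1 hl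
  rcases le_total 0 (z 1) with hs | hs
  · refine JoinedIn.trans (y := !₂[z 0, 1]) ?_ (hU (by simp; nlinarith) (by norm_num))
    refine joinedIn_region_of_forall fun t h0 h1 u hu => (mem_region_iff u).2 ?_
    have e0 : u 0 = z 0 := by rw [hu 0]; simp; ring
    have e1 : u 1 = (1 - t) * z 1 + t := by rw [hu 1]; simp
    have h2 : z 1 ≤ u 1 := by rw [e1]; nlinarith
    have h3 : u 1 ≤ 1 := by rw [e1]; nlinarith
    rw [e0]
    refine ⟨by nlinarith, by nlinarith, by nlinarith⟩
  · refine JoinedIn.trans (y := !₂[z 0, -1]) ?_ (hL (by simp; nlinarith) (by norm_num))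
    refine joinedIn_region_of_forall fun t h0 h1 u hu => (mem_region_iff u).2 ?_
    have e0 : u 0 = z 0 := by rw [hu 0]; simp; ring
    have e1 : u 1 = (1 - t) * z 1 - t := by rw [hu 1]; simp; ring
    have h2 : u 1 ≤ z 1 := by rw [e1]; nlinarith
    have h3 : -1 ≤ u 1 := by rw [e1]; nlinarith
    rw [e0]
    refine ⟨by nlinarith, by nlinarith, by nlinarith⟩

theorem isConnected_region : IsConnected region := by
  have h : (!₂[6, 1] : Plane) ∈ region := (mem_region_iff _).2 (by norm_num)
  exact IsPathConnected.isConnected ⟨_, h, fun {_} hz => (joinedIn_top hz).symm⟩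

theorem reflect_eq_self {j : Fin 3} {z : Plane} (h : dist z (center j) = radius j) :
    reflect j z = z :=
  EuclideanGeometry.inversion_of_mem_sphere h

/-- Every gluing circle lies in the pair of pants. -/
theorem exists_mem_reflect_mem (j : Fin 3) : ∃ z ∈ region, reflect j z ∈ region := by
  have h : ∃ z ∈ region, dist z (center j) = radius j := by
    fin_cases j
    · refine ⟨!₂[0, 9], (mem_region_iff _).2 (by norm_num), ?_⟩
      simp [center, radius, EuclideanSpace.norm_eq]
    · refine ⟨!₂[0, 1], (mem_region_iff _).2 (by norm_num), ?_⟩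
      simp [center, radius, EuclideanSpace.norm_eq]
    · refine ⟨!₂[5, 1], (mem_region_iff _).2 (by norm_num), ?_⟩
      simp [center, radius, EuclideanSpace.dist_eq]
  obtain ⟨z, hz, h⟩ := h
  exact ⟨z, hz, by rwa [reflect_eq_self h]⟩

end Pants

/-! ### The torus and smooth lifts -/

/-- The two-dimensional torus. -/
abbrev Torus : Type := UnitAddCircle × UnitAddCircle

/-- The universal covering of the torus. -/
def torusMk (v : Plane) : Torus := ((v 0 : UnitAddCircle), (v 1 : UnitAddCircle))

theorem continuous_torusMk : Continuous torusMk := by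
  have h : ∀ i, Continuous fun v : Plane => ((v i : ℝ) : UnitAddCircle) := fun i =>
    (AddCircle.continuous_mk' 1).comp (by fun_prop)
  exact (h 0).prodMk (h 1)

theorem torusMk_add (v w : Plane) : torusMk (v + w) = torusMk v + torusMk w := by
  simp [torusMk]

theorem torusMk_sub (v w : Plane) : torusMk (v - w) = torusMk v - torusMk w := by
  simp [torusMk]

/-- The covering of the torus is injective at distances less than `1`. -/
theorem eq_of_torusMk_eq {v w : Plane} (h : torusMk v = torusMk w) (hd : dist v w < 1) :
    v = w := by
  have key : ∀ i, ((v i : ℝ) : UnitAddCircle) = (w i : UnitAddCircle) → v i = w i := by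
    intro i hi
    have h0 : ((v i - w i : ℝ) : UnitAddCircle) = 0 := by rw [AddCircle.coe_sub, hi, sub_self]
    obtain ⟨n, hn⟩ := (AddCircle.coe_eq_zero_iff 1).1 h0
    have h1 : |v i - w i| < 1 := by
      have := PiLp.norm_apply_le (v - w) i
      rw [← dist_eq_norm] at this
      exact lt_of_le_of_lt this hd
    rw [← hn, zsmul_eq_mul, mul_one, ← Int.cast_abs] at h1
    have : n = 0 := Int.abs_lt_one_iff.1 (Int.cast_lt (R := ℝ).1 (by rw [Int.cast_one]; exact h1))
    rw [this, zero_smul] at hn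
    linarith
  have h' := Prod.ext_iff.1 h
  ext i
  fin_cases i
  · exact key 0 h'.1
  · exact key 1 h'.2

/-- Every point of the torus has a representative in the unit square. -/
theorem exists_torusMk_eq (x : Torus) :
    ∃ v : Plane, (∀ i, v i ∈ Icc (0 : ℝ) 1) ∧ torusMk v = x := by
  have h : ∀ y : UnitAddCircle, ∃ t ∈ Icc (0 : ℝ) 1, (t : UnitAddCircle) = y := fun y => by
    have := (AddCircle.coe_image_Icc_eq (p := (1 : ℝ)) 0).symm ▸ mem_univ y
    obtain ⟨t, ht, e⟩ := this
    exact ⟨t, by simpa using ht, e⟩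
  obtain ⟨s, hs, h1⟩ := h x.1
  obtain ⟨t, ht, h2⟩ := h x.2
  refine ⟨!₂[s, t], fun i => ?_, ?_⟩
  · fin_cases i
    · exact hs
    · exact ht
  · simp [torusMk, h1, h2]

/-- A self-map of the torus is covered by smooth maps of the plane, with any prescribed admissible
value at a given point. -/
def HasSmoothLifts (g : Torus → Torus) : Prop :=
  ∀ w w' : Plane, torusMk w' = g (torusMk w) →
    ∃ f : Plane → Plane, ContDiff ℝ ∞ f ∧ f w = w' ∧ ∀ u, torusMk (f u) = g (torusMk u)

theorem HasSmoothLifts.of_lift {g : Torus → Torus} (f : Plane → Plane) (hf : ContDiff ℝ ∞ f)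
    (h : ∀ u, torusMk (f u) = g (torusMk u)) : HasSmoothLifts g := fun w w' hw =>
  ⟨fun u => f u + (w' - f w), hf.add contDiff_const, add_sub_cancel _ _, fun u => by
    rw [torusMk_add, torusMk_sub, hw, h, h, sub_self, add_zero]⟩

theorem HasSmoothLifts.id : HasSmoothLifts id :=
  .of_lift _root_.id contDiff_id fun _ => rfl

namespace Pants

/-! ### The suspension -/

/-- The holonomy of the passage through the `j`-th gluing circle, from the first copy of the pair
of pants (`true`) to the second one (`false`) or back. -/
def holonomy (f : Fin 3 → Torus ≃ₜ Torus) (ε : Bool) (j : Fin 3) : Torus ≃ₜ Torus :=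
  if ε then f j else (f j).symm

theorem holonomy_not (f : Fin 3 → Torus ≃ₜ Torus) (ε : Bool) (j : Fin 3) :
    holonomy f (!ε) j = (holonomy f ε j).symm := by
  cases ε <;> simp [holonomy]

/-- The disjoint union of two copies of the product of the pair of pants with the plane. -/
abbrev Sheets : Type := Bool × region × Plane

/-- The gluing of `Sheets`: the plane covers the torus, and the two copies of the pair of pants are
glued along their collars by the inversions, while the torus is transformed by the holonomy. -/
def gluing (f : Fin 3 → Torus ≃ₜ Torus) : Setoid Sheets where
  r p p' :=
    (p'.1 = p.1 ∧ p'.2.1 = p.2.1 ∧ torusMk p'.2.2 = torusMk p.2.2) ∨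
    (p'.1 = !p.1 ∧ ∃ j, (p'.2.1 : Plane) = reflect j p.2.1 ∧
      torusMk p'.2.2 = holonomy f p.1 j (torusMk p.2.2))
  iseqv :=
    { refl := fun p => Or.inl ⟨rfl, rfl, rfl⟩
      symm := by
        rintro ⟨ε, z, w⟩ ⟨ε', z', w'⟩ (⟨h1, h2, h3⟩ | ⟨h1, j, h2, h3⟩)
        · exact Or.inl ⟨h1.symm, h2.symm, h3.symm⟩
        · dsimp only at h1 h2 h3
          subst h1
          refine Or.inr ⟨by simp, j, ?_, ?_⟩
          · simp [h2, reflect_reflect]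
          · simp [holonomy_not, h3]
      trans := by
        rintro ⟨ε, z, w⟩ ⟨ε', z', w'⟩ ⟨ε'', z'', w''⟩ (⟨h1, h2, h3⟩ | ⟨h1, j, h2, h3⟩)
          (⟨h4, h5, h6⟩ | ⟨h4, k, h5, h6⟩) <;> dsimp only at h1 h2 h3 h4 h5 h6
        · exact Or.inl ⟨h4.trans h1, h5.trans h2, h6.trans h3⟩
        · subst h1 h2
          exact Or.inr ⟨h4, k, h5, by rw [h6, h3]⟩
        · subst h4 h5
          exact Or.inr ⟨h1, j, h2, by rw [h6, h3]⟩
        -- a point of the sheet lies in the collar of at most one gluing circle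
        · have hjk : j = k := reflect_index_unique z'.2 z'.2 (by simp)
            (by rw [h2, reflect_reflect]; exact z.2) (h5 ▸ z''.2)
          subst h1 h4 hjk
          refine Or.inl ⟨by simp, Subtype.ext ?_, ?_⟩
          · rw [h5, h2, reflect_reflect]
          · rw [h6, h3, holonomy_not]; simp }

/-- The total space of the suspension: a bundle with fibre the torus over the closed surface of
genus two obtained by gluing two pairs of pants. -/
def Suspension (f : Fin 3 → Torus ≃ₜ Torus) : Type := Quotient (gluing f)

namespace Suspension

variable (f : Fin 3 → Torus ≃ₜ Torus)

instance : TopologicalSpace (Suspension f) :=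
  inferInstanceAs (TopologicalSpace (Quotient (gluing f)))

/-- The projection of the disjoint union of the sheets to the suspension. -/
def proj (p : Sheets) : Suspension f := Quotient.mk (gluing f) p

theorem proj_eq_iff {p p' : Sheets} : proj f p = proj f p' ↔
    (p'.1 = p.1 ∧ p'.2.1 = p.2.1 ∧ torusMk p'.2.2 = torusMk p.2.2) ∨
    (p'.1 = !p.1 ∧ ∃ j, (p'.2.1 : Plane) = reflect j p.2.1 ∧
      torusMk p'.2.2 = holonomy f p.1 j (torusMk p.2.2)) :=
  Quotient.eq (r := gluing f)

theorem isQuotientMap_proj : IsQuotientMap (proj f) := isQuotientMap_quot_mk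

open Classical in
/-- The parametrization of one half of the suspension by the product of the pair of pants and the
plane; it is extended by a junk value to the product of two planes. -/
noncomputable def param (ε : Bool) (p : Plane × Plane) : Suspension f :=
  if h : p.1 ∈ region then proj f (ε, ⟨p.1, h⟩, p.2)
  else proj f (true, ⟨_, isConnected_region.nonempty.some_mem⟩, 0)

/-- The domain of the parametrizations. -/
def domain : Set (Plane × Plane) := {p | p.1 ∈ region}

theorem isOpen_domain : IsOpen domain := isOpen_region.preimage continuous_fst

theorem param_of_mem (ε : Bool) {p : Plane × Plane} (h : p ∈ domain) :
    param f ε p = proj f (ε, ⟨p.1, h⟩, p.2) := dif_pos h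

theorem continuousOn_param (ε : Bool) : ContinuousOn (param f ε) domain := by
  rw [continuousOn_iff_continuous_domRestrict]
  have : domain.domRestrict (param f ε) =
      fun p : domain => proj f (ε, ⟨p.1.1, p.2⟩, p.1.2) := by
    ext p
    exact param_of_mem f ε p.2
  rw [this]
  refine (isQuotientMap_proj f).continuous.comp ?_
  refine continuous_const.prodMk (Continuous.prodMk ?_ ?_)
  · exact Continuous.subtype_mk (continuous_fst.comp continuous_subtype_val) _
  · exact continuous_snd.comp continuous_subtype_val

theorem exists_param (x : Suspension f) : ∃ ε, ∃ p ∈ domain, param f ε p = x := by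
  obtain ⟨⟨ε, z, w⟩, rfl⟩ := (isQuotientMap_proj f).surjective x
  exact ⟨ε, (z.1, w), z.2, param_of_mem f ε (p := (z.1, w)) z.2⟩

theorem param_eq_iff {ε ε' : Bool} {p p' : Plane × Plane} (h : p ∈ domain) (h' : p' ∈ domain) :
    param f ε p = param f ε' p' ↔
      (ε' = ε ∧ p'.1 = p.1 ∧ torusMk p'.2 = torusMk p.2) ∨
      (ε' = !ε ∧ ∃ j, p'.1 = reflect j p.1 ∧ torusMk p'.2 = holonomy f ε j (torusMk p.2)) := by
  rw [param_of_mem f ε h, param_of_mem f ε' h', proj_eq_iff]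
  simp [Subtype.ext_iff]

theorem param_injOn (ε : Bool) (w : Plane) {r : ℝ} (hr : r ≤ 1 / 2) :
    InjOn (param f ε) (region ×ˢ Metric.ball w r) := by
  rintro ⟨z, v⟩ ⟨hz, hv⟩ ⟨z', v'⟩ ⟨hz', hv'⟩ h
  rcases (param_eq_iff f (p := (z, v)) (p' := (z', v')) hz hz').1 h with ⟨-, h1, h2⟩ | ⟨h1, -⟩
  · have := eq_of_torusMk_eq h2 (by
      have := dist_triangle_right v' v w
      have h3 := Metric.mem_ball.1 hv
      have h4 := Metric.mem_ball.1 hv'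
      dsimp only at h3 h4 ⊢
      linarith)
    exact Prod.ext h1.symm this.symm
  · simp at h1

variable {f}

/-- Two parametrizations of a point are locally related by a smooth map which is a product of a map
in the leaf direction and a map in the transverse direction. -/
theorem exists_local_transition (hf : ∀ ε j, HasSmoothLifts (holonomy f ε j)) {ε ε' : Bool}
    {p p' : Plane × Plane} (h : p ∈ domain) (h' : p' ∈ domain)
    (he : param f ε p = param f ε' p') :
    ∃ g k : Plane → Plane, ContDiffAt ℝ ∞ g p.1 ∧ ContDiff ℝ ∞ k ∧ g p.1 = p'.1 ∧ k p.2 = p'.2 ∧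
      ∀ᶠ u in 𝓝 p, (g u.1, k u.2) ∈ domain ∧ param f ε' (g u.1, k u.2) = param f ε u := by
  have key : ∀ g k : Plane → Plane, ContDiffAt ℝ ∞ g p.1 → g p.1 = p'.1 →
      ∀ᶠ u in 𝓝 p, u ∈ domain ∧ (g u.1, k u.2) ∈ domain := fun g k hg hgp => by
    refine (isOpen_domain.eventually_mem h).and ?_
    have : Tendsto (fun u : Plane × Plane => g u.1) (𝓝 p) (𝓝 p'.1) := by
      rw [← hgp]
      exact hg.continuousAt.tendsto.comp continuous_fst.continuousAt
    exact this (isOpen_region.mem_nhds h')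
  rcases (param_eq_iff f h h').1 he with ⟨rfl, h1, h2⟩ | ⟨rfl, j, h1, h2⟩
  · obtain ⟨k, hk, hk1, hk2⟩ := HasSmoothLifts.id p.2 p'.2 h2
    refine ⟨id, k, contDiffAt_id, hk, h1.symm, hk1, ?_⟩
    filter_upwards [key id k contDiffAt_id h1.symm] with u hu
    refine ⟨hu.2, ?_⟩
    rw [eq_comm, param_eq_iff f hu.1 hu.2]
    exact Or.inl ⟨rfl, rfl, hk2 u.2⟩
  · obtain ⟨k, hk, hk1, hk2⟩ := hf ε j p.2 p'.2 h2
    refine ⟨reflect j, k, contDiffAt_reflect h j, hk, h1.symm, hk1, ?_⟩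
    filter_upwards [key (reflect j) k (contDiffAt_reflect h j) h1.symm] with u hu
    refine ⟨hu.2, ?_⟩
    rw [eq_comm, param_eq_iff f hu.1 hu.2]
    exact Or.inr ⟨rfl, j, rfl, hk2 u.2⟩

theorem isOpen_param_image (hf : ∀ ε j, HasSmoothLifts (holonomy f ε j)) (ε : Bool)
    {U : Set (Plane × Plane)} (hU : IsOpen U) (hUd : U ⊆ domain) : IsOpen (param f ε '' U) := by
  rw [← (isQuotientMap_proj f).isOpen_preimage, isOpen_iff_mem_nhds]
  rintro ⟨ε', z', w'⟩ ⟨p, hp, he⟩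
  have hz : (z'.1, w') ∈ domain := z'.2
  rw [← param_of_mem f ε' hz] at he
  obtain ⟨g, k, hg, hk, hgp, hkp, hev⟩ := exists_local_transition hf hz (hUd hp) he.symm
  have hev' : ∀ᶠ u in 𝓝 (z'.1, w'), (g u.1, k u.2) ∈ U := by
    have h1 : Tendsto (fun u : Plane × Plane => (g u.1, k u.2)) (𝓝 (z'.1, w')) (𝓝 p) := by
      have : p = (g z'.1, k w') := Prod.ext hgp.symm hkp.symm
      rw [this]
      exact (hg.continuousAt.tendsto.comp continuous_fst.continuousAt).prodMk_nhds
        (hk.continuous.continuousAt.tendsto.comp continuous_snd.continuousAt)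
    exact h1 (hU.mem_nhds hp)
  have hcont : Tendsto (fun u : Sheets => (u.2.1.1, u.2.2)) (𝓝 (ε', z', w')) (𝓝 (z'.1, w')) :=
    Continuous.tendsto (f := fun u : Sheets => (u.2.1.1, u.2.2)) (by fun_prop) (ε', z', w')
  have hε : ∀ᶠ u : Sheets in 𝓝 (ε', z', w'), u.1 = ε' := by
    have : ContinuousAt (fun u : Sheets => u.1) (ε', z', w') := continuous_fst.continuousAt
    exact this ((isOpen_discrete {ε'}).mem_nhds rfl)
  filter_upwards [hε, hcont.eventually (hev.and hev')] with u hu1 hu2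
  refine ⟨_, hu2.2, ?_⟩
  rw [hu2.1.2, ← hu1]
  exact param_of_mem f u.1 (p := (u.2.1.1, u.2.2)) u.2.1.2

theorem isOpenQuotientMap_proj (hf : ∀ ε j, HasSmoothLifts (holonomy f ε j)) :
    IsOpenQuotientMap (proj f) where
  surjective := (isQuotientMap_proj f).surjective
  continuous := (isQuotientMap_proj f).continuous
  isOpenMap := by
    intro V hV
    have : proj f '' V = ⋃ ε, param f ε '' {p | ∃ h : p.1 ∈ region, (ε, ⟨p.1, h⟩, p.2) ∈ V} := by
      ext x
      simp only [mem_image, mem_iUnion]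
      constructor
      · rintro ⟨⟨ε, z, w⟩, hp, rfl⟩
        exact ⟨ε, (z.1, w), ⟨z.2, hp⟩, param_of_mem f ε (p := (z.1, w)) z.2⟩
      · rintro ⟨ε, p, ⟨h, hp⟩, rfl⟩
        exact ⟨_, hp, (param_of_mem f ε h).symm⟩
    rw [this]
    refine isOpen_iUnion fun ε => isOpen_param_image hf ε ?_ (fun p hp => hp.1)
    have h1 : IsOpen {p : domain | ((ε, ⟨p.1.1, p.2⟩, p.1.2) : Sheets) ∈ V} := by
      refine hV.preimage (continuous_const.prodMk (Continuous.prodMk ?_ ?_))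
      · exact Continuous.subtype_mk (continuous_fst.comp continuous_subtype_val) _
      · exact continuous_snd.comp continuous_subtype_val
    convert isOpen_domain.isOpenMap_subtype_val _ h1 using 1
    ext p
    constructor
    · rintro ⟨h, hp⟩
      exact ⟨⟨p, h⟩, hp, rfl⟩
    · rintro ⟨⟨p, h⟩, hp, rfl⟩
      exact ⟨h, hp⟩

theorem t2Space (hf : ∀ ε j, HasSmoothLifts (holonomy f ε j)) : T2Space (Suspension f) := by
  rw [t2Space_iff_of_isOpenQuotientMap (isOpenQuotientMap_proj hf)]
  have hT : Continuous torusMk := continuous_torusMk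
  have hr : ∀ j, Continuous fun z : region => reflect j z := fun j =>
    continuous_iff_continuousAt.2 fun z =>
      (contDiffAt_reflect z.2 j).continuousAt.comp continuous_subtype_val.continuousAt
  have : {q : Sheets × Sheets | proj f q.1 = proj f q.2} =
      {q | q.2.1 = q.1.1 ∧ q.2.2.1 = q.1.2.1 ∧ torusMk q.2.2.2 = torusMk q.1.2.2} ∪
      ⋃ j, ⋃ ε, {q | q.1.1 = ε ∧ q.2.1 = !q.1.1 ∧ (q.2.2.1 : Plane) = reflect j q.1.2.1 ∧
        torusMk q.2.2.2 = holonomy f ε j (torusMk q.1.2.2)} := by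
    ext q
    simp only [mem_ofPred_eq, proj_eq_iff, mem_union, mem_iUnion]
    refine or_congr_right ⟨?_, ?_⟩
    · rintro ⟨h, j, h1, h2⟩
      exact ⟨j, _, rfl, h, h1, h2⟩
    · rintro ⟨j, _, rfl, h, h1, h2⟩
      exact ⟨h, j, h1, h2⟩
  rw [this]
  refine IsClosed.union ?_ (isClosed_iUnion_of_finite fun j =>
    isClosed_iUnion_of_finite fun ε => ?_)
  · refine (isClosed_eq (by fun_prop) (by fun_prop)).inter
      ((isClosed_eq (by fun_prop) (by fun_prop)).inter (isClosed_eq (by fun_prop) (by fun_prop)))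
  · refine (isClosed_eq (by fun_prop) (by fun_prop)).inter
      ((isClosed_eq (by fun_prop) ?_).inter
      ((isClosed_eq (by fun_prop) ((hr j).comp (by fun_prop))).inter
      (isClosed_eq (by fun_prop) (by fun_prop))))
    exact (continuous_of_discreteTopology (f := not)).comp (by fun_prop)

/-- The compact fundamental region: the compact pair of pants times the unit square. -/
def fundamental : Set (Plane × Plane) := core ×ˢ {v : Plane | ∀ i, v i ∈ Icc (0 : ℝ) 1}

theorem fundamental_subset_domain : fundamental ⊆ domain := fun _ hp => core_subset_region hp.1

theorem isCompact_unitSquare : IsCompact {v : Plane | ∀ i, v i ∈ Icc (0 : ℝ) 1} := by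
  have h : IsCompact (Set.pi univ fun _ : Fin 2 => Icc (0 : ℝ) 1) :=
    isCompact_univ_pi fun _ => isCompact_Icc
  have := h.image (PiLp.continuous_toLp 2 (fun _ : Fin 2 => ℝ))
  convert this using 1
  ext v
  constructor
  · intro hv
    exact ⟨fun i => v i, fun i _ => hv i, rfl⟩
  · rintro ⟨u, hu, rfl⟩ i
    exact hu i (mem_univ i)

theorem isCompact_fundamental : IsCompact fundamental := isCompact_core.prod isCompact_unitSquare

theorem exists_mem_fundamental (x : Suspension f) : ∃ ε, ∃ p ∈ fundamental, param f ε p = x := by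
  obtain ⟨ε, p, hp, rfl⟩ := exists_param f x
  by_cases hc : p.1 ∈ core
  · obtain ⟨v, hv, hv'⟩ := exists_torusMk_eq (torusMk p.2)
    have h' : (p.1, v) ∈ domain := hp
    refine ⟨ε, (p.1, v), ⟨hc, hv⟩, (param_eq_iff f h' hp).2 (Or.inl ⟨rfl, rfl, hv'.symm⟩)⟩
  · obtain ⟨j, hj⟩ := exists_reflect_mem_core hp hc
    obtain ⟨v, hv, hv'⟩ := exists_torusMk_eq (holonomy f ε j (torusMk p.2))
    have h' : (reflect j p.1, v) ∈ domain := core_subset_region hj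
    refine ⟨!ε, (reflect j p.1, v), ⟨hj, hv⟩, ?_⟩
    exact ((param_eq_iff f hp h').2 (Or.inr ⟨rfl, j, rfl, hv'⟩)).symm

theorem compactSpace : CompactSpace (Suspension f) := by
  refine ⟨?_⟩
  have h : (univ : Set (Suspension f)) = ⋃ ε, param f ε '' fundamental := by
    ext x
    obtain ⟨ε, p, hp, rfl⟩ := exists_mem_fundamental x
    exact iff_of_true trivial (mem_iUnion.2 ⟨ε, p, hp, rfl⟩)
  rw [h]
  exact isCompact_iUnion fun ε =>
    isCompact_fundamental.image_of_continuousOn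
      ((continuousOn_param f ε).mono fundamental_subset_domain)

theorem connectedSpace : ConnectedSpace (Suspension f) := by
  have hd : IsConnected domain := by
    have : domain = region ×ˢ (univ : Set Plane) := by ext; simp [domain]
    rw [this]
    exact isConnected_region.prod isConnected_univ
  have h : ∀ ε, IsConnected (param f ε '' domain) := fun ε =>
    hd.image _ (continuousOn_param f ε)
  have hu : (univ : Set (Suspension f)) = param f true '' domain ∪ param f false '' domain := by
    ext x
    obtain ⟨ε, p, hp, rfl⟩ := exists_param f x
    cases ε
    · exact iff_of_true trivial (Or.inr ⟨p, hp, rfl⟩)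
    · exact iff_of_true trivial (Or.inl ⟨p, hp, rfl⟩)
  have hn : (param f true '' domain ∩ param f false '' domain).Nonempty := by
    obtain ⟨z, hz, hz'⟩ := exists_mem_reflect_mem 0
    obtain ⟨v, -, hv⟩ := exists_torusMk_eq (holonomy f true 0 (torusMk 0))
    have h1 : (z, (0 : Plane)) ∈ domain := hz
    have h2 : (reflect 0 z, v) ∈ domain := hz'
    exact ⟨_, ⟨_, h1, rfl⟩, ⟨_, h2, ((param_eq_iff f h1 h2).2 (Or.inr ⟨rfl, 0, rfl, hv⟩)).symm⟩⟩
  have := IsConnected.union hn (h true) (h false)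
  rw [← hu] at this
  exact connectedSpace_iff_univ.2 this

end Suspension

end Pants

namespace Pants

namespace Suspension

/-! ### The smooth structure and the foliation of the suspension -/

/-- The monodromy maps of a suspension and their inverses are smooth diffeomorphisms. -/
class IsSmoothMonodromy (f : Fin 3 → Torus ≃ₜ Torus) : Prop where
  lifts : ∀ ε j, HasSmoothLifts (holonomy f ε j)

/-- A product of two discs on which a parametrization of the suspension is injective. -/
structure Box where
  /-- The sheet of the box. -/
  sheet : Bool
  /-- The centre of the disc in the pair of pants. -/
  leafCenter : Plane
  /-- The radius of the disc in the pair of pants. -/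
  leafRadius : ℝ
  /-- The centre of the transverse disc. -/
  transCenter : Plane
  /-- The radius of the transverse disc. -/
  transRadius : ℝ
  leafRadius_pos : 0 < leafRadius
  transRadius_pos : 0 < transRadius
  transRadius_le : transRadius ≤ 1 / 2
  subset_region : Metric.ball leafCenter leafRadius ⊆ region

/-- The product of discs underlying a box. -/
def Box.carrier (b : Box) : Set (Plane × Plane) :=
  Metric.ball b.leafCenter b.leafRadius ×ˢ Metric.ball b.transCenter b.transRadius

theorem Box.isOpen_carrier (b : Box) : IsOpen b.carrier :=
  Metric.isOpen_ball.prod Metric.isOpen_ball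

theorem Box.carrier_subset_domain (b : Box) : b.carrier ⊆ domain := fun _ hp => b.subset_region hp.1

variable (f : Fin 3 → Torus ≃ₜ Torus)

theorem Box.injOn_param (b : Box) : InjOn (param f b.sheet) b.carrier :=
  (param_injOn f b.sheet b.transCenter b.transRadius_le).mono
    (prod_mono b.subset_region subset_rfl)

variable [IsSmoothMonodromy f]

/-- The foliated chart of the suspension given by a box. -/
noncomputable def boxChart (b : Box) : OpenPartialHomeomorph (Suspension f) (FoliatedModel 2 2) :=
  (OpenPartialHomeomorph.ofContinuousOpenRestrict ((b.injOn_param f).toPartialEquiv _ _)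
    ((continuousOn_param f b.sheet).mono b.carrier_subset_domain)
    (by
      intro V hV
      have h := isOpen_param_image IsSmoothMonodromy.lifts b.sheet (f := f)
        (b.isOpen_carrier.isOpenMap_subtype_val V hV)
        ((Subtype.coe_image_subset _ _).trans b.carrier_subset_domain)
      exact (image_comp (param f b.sheet) Subtype.val V).symm ▸ h) b.isOpen_carrier).symm

variable (b : Box)

theorem boxChart_symm_apply (p : Plane × Plane) : (boxChart f b).symm p = param f b.sheet p := rfl

theorem boxChart_param {p : Plane × Plane} (hp : p ∈ b.carrier) :
    boxChart f b (param f b.sheet p) = p :=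
  (boxChart f b).right_inv hp

theorem exists_box_of_mem {z : Plane} (hz : z ∈ region) (ε : Bool) (w : Plane) :
    ∃ b : Box, b.sheet = ε ∧ (z, w) ∈ b.carrier := by
  obtain ⟨r, hr, h⟩ := Metric.isOpen_iff.1 isOpen_region z hz
  exact ⟨⟨ε, z, r, w, 1 / 2, hr, by norm_num, le_rfl, h⟩, rfl, Metric.mem_ball_self hr,
    Metric.mem_ball_self (by norm_num)⟩

theorem exists_mem_boxChart_source (x : Suspension f) : ∃ b, x ∈ (boxChart f b).source := by
  obtain ⟨ε, p, hp, rfl⟩ := exists_param f x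
  obtain ⟨b, rfl, h⟩ := exists_box_of_mem (z := p.1) hp ε p.2
  exact ⟨b, p, h, rfl⟩

/-- The changes of foliated charts are smooth and locally of product form. -/
theorem boxChart_transition (b b' : Box) {x : Suspension f} (hx : x ∈ (boxChart f b).source)
    (hx' : x ∈ (boxChart f b').source) :
    ∃ g k : Plane → Plane, ContDiffAt ℝ ∞ g (boxChart f b x).1 ∧ ContDiff ℝ ∞ k ∧
      ∀ᶠ u in 𝓝 (boxChart f b x), boxChart f b' ((boxChart f b).symm u) = (g u.1, k u.2) := by
  obtain ⟨p, hp, rfl⟩ := hx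
  obtain ⟨p', hp', he⟩ := hx'
  rw [boxChart_param f b hp]
  obtain ⟨g, k, hg, hk, hgp, hkp, hev⟩ := exists_local_transition
    (IsSmoothMonodromy.lifts) (b.carrier_subset_domain hp) (b'.carrier_subset_domain hp') he.symm
  refine ⟨g, k, hg, hk, ?_⟩
  have h1 : Tendsto (fun u : Plane × Plane => (g u.1, k u.2)) (𝓝 p) (𝓝 p') := by
    have : p' = (g p.1, k p.2) := Prod.ext hgp.symm hkp.symm
    rw [this]
    exact (hg.continuousAt.tendsto.comp continuous_fst.continuousAt).prodMk_nhds
      (hk.continuous.continuousAt.tendsto.comp continuous_snd.continuousAt)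
  filter_upwards [hev, h1 (b'.isOpen_carrier.mem_nhds hp')] with u hu hu'
  rw [boxChart_symm_apply, ← hu.2, boxChart_param f b' hu']

/-- The identification of the product of two planes with the four-dimensional space. -/
noncomputable def modelEquiv : (Plane × Plane) ≃L[ℝ] EuclideanSpace ℝ (Fin 4) :=
  ContinuousLinearEquiv.ofFinrankEq (by simp)

/-- The chart with values in the four-dimensional space given by a box. -/
noncomputable def manifoldChart (b : Box) :
    OpenPartialHomeomorph (Suspension f) (EuclideanSpace ℝ (Fin 4)) :=
  (boxChart f b).transHomeomorph modelEquiv.toHomeomorph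

noncomputable instance : ChartedSpace (EuclideanSpace ℝ (Fin 4)) (Suspension f) where
  atlas := range (manifoldChart f)
  chartAt x := manifoldChart f (exists_mem_boxChart_source f x).choose
  mem_chart_source x := (exists_mem_boxChart_source f x).choose_spec
  chart_mem_atlas _ := mem_range_self _

instance : IsManifold (𝓡 4) ∞ (Suspension f) := by
  refine isManifold_of_contDiffOn _ _ _ ?_
  rintro _ _ ⟨b, rfl⟩ ⟨b', rfl⟩
  simp only [mfld_simps]
  rintro v ⟨hv, hv'⟩
  have hv1 : modelEquiv.symm v ∈ b.carrier := hv
  obtain ⟨g, k, hg, hk, hev⟩ := boxChart_transition f b b'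
    ((boxChart f b).map_target hv1) hv'
  rw [(boxChart f b).right_inv hv1] at hev hg
  refine ContDiffAt.contDiffWithinAt ?_
  have h1 : ContDiffAt ℝ ∞ (fun u => modelEquiv (g (modelEquiv.symm u).1, k (modelEquiv.symm u).2))
      v := by
    refine modelEquiv.contDiff.contDiffAt.comp v (ContDiffAt.prodMk ?_ ?_)
    · exact ContDiffAt.comp v (g := g) hg
        ((contDiff_fst.comp modelEquiv.symm.contDiff).contDiffAt)
    · exact (hk.comp (contDiff_snd.comp modelEquiv.symm.contDiff)).contDiffAt
  refine h1.congr_of_eventuallyEq ?_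
  have h2 : Tendsto modelEquiv.symm (𝓝 v) (𝓝 (modelEquiv.symm v)) :=
    modelEquiv.symm.continuous.continuousAt
  filter_upwards [h2.eventually hev] with u hu
  exact congrArg modelEquiv hu

theorem isSmoothBoxChart_boxChart : IsSmoothBoxChart 4 (boxChart f b) := by
  have hmem : manifoldChart f b ∈ IsManifold.maximalAtlas (𝓡 4) ∞ (Suspension f) :=
    IsManifold.subset_maximalAtlas (mem_range_self b)
  refine ⟨?_, ?_, _, _, _, _, b.leafRadius_pos, b.transRadius_pos, rfl⟩
  · have h1 := contMDiffOn_of_mem_maximalAtlas hmem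
    have h2 : ContMDiff (𝓡 4) 𝓘(ℝ, FoliatedModel 2 2) ∞ modelEquiv.symm :=
      modelEquiv.symm.contDiff.contMDiff
    refine (h2.comp_contMDiffOn h1).congr fun _ _ => ?_
    exact (modelEquiv.symm_apply_apply _).symm
  · have h1 := contMDiffOn_symm_of_mem_maximalAtlas hmem
    have h2 : ContMDiff 𝓘(ℝ, FoliatedModel 2 2) (𝓡 4) ∞ modelEquiv :=
      modelEquiv.contDiff.contMDiff
    refine (h1.comp h2.contMDiffOn fun p hp => ?_).congr fun p hp => ?_
    · change modelEquiv.symm (modelEquiv p) ∈ b.carrier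
      rw [modelEquiv.symm_apply_apply]
      exact hp
    · change _ = (boxChart f b).symm (modelEquiv.symm (modelEquiv p))
      rw [modelEquiv.symm_apply_apply]

theorem plaqueCompatible_boxChart (b b' : Box) :
    PlaqueCompatible (boxChart f b) (boxChart f b') := by
  rintro x ⟨hx, hx'⟩
  obtain ⟨g, k, hg, hk, hev⟩ := boxChart_transition f b b' hx hx'
  refine ⟨k, ?_⟩
  filter_upwards [((boxChart f b).continuousAt hx).eventually hev,
    (boxChart f b).open_source.mem_nhds hx] with z hz hz'
  rw [(boxChart f b).left_inv hz'] at hz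
  rw [hz]

theorem plaqueCompatible_trans {M : Type*} [TopologicalSpace M] {d q : ℕ}
    {e e' : OpenPartialHomeomorph M (FoliatedModel d q)}
    (h : ∀ x ∈ e.source ∩ e'.source, ∃ e'' : OpenPartialHomeomorph M (FoliatedModel d q),
      x ∈ e''.source ∧ PlaqueCompatible e e'' ∧ PlaqueCompatible e'' e') :
    PlaqueCompatible e e' := by
  rintro x hx
  obtain ⟨e'', hx'', h1, h2⟩ := h x hx
  obtain ⟨γ, hγ⟩ := h1 x ⟨hx.1, hx''⟩
  obtain ⟨δ, hδ⟩ := h2 x ⟨hx'', hx.2⟩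
  refine ⟨δ ∘ γ, ?_⟩
  filter_upwards [hγ, hδ] with z h1 h2
  rw [h2, h1, Function.comp_apply]

/-- The foliation of the suspension by the images of the pair of pants. -/
noncomputable def foliation : Foliation (Suspension f) 4 2 2 where
  charts := {e | IsSmoothBoxChart 4 e ∧
    ∀ b, PlaqueCompatible e (boxChart f b) ∧ PlaqueCompatible (boxChart f b) e}
  smooth _ he := he.1
  cover x := by
    obtain ⟨b, hb⟩ := exists_mem_boxChart_source f x
    exact ⟨_, ⟨isSmoothBoxChart_boxChart f b, fun b' =>
      ⟨plaqueCompatible_boxChart f b b', plaqueCompatible_boxChart f b' b⟩⟩, hb⟩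
  compatible e he e' he' := plaqueCompatible_trans fun x _ => by
    obtain ⟨b, hb⟩ := exists_mem_boxChart_source f x
    exact ⟨_, hb, (he.2 b).1, (he'.2 b).2⟩
  maximal e he h := ⟨he, fun b => h _ ⟨isSmoothBoxChart_boxChart f b, fun b' =>
    ⟨plaqueCompatible_boxChart f b b', plaqueCompatible_boxChart f b' b⟩⟩⟩

theorem boxChart_mem_charts : boxChart f b ∈ (foliation f).charts :=
  ⟨isSmoothBoxChart_boxChart f b, fun b' =>
    ⟨plaqueCompatible_boxChart f b b', plaqueCompatible_boxChart f b' b⟩⟩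

end Suspension

end Pants

namespace Pants

/-! ### Leaves and holonomy orbits -/

/-- The orbit equivalence relation on the torus of the group generated by the monodromy. -/
def orbitSetoid (f : Fin 3 → Torus ≃ₜ Torus) : Setoid Torus where
  r x y := ∃ g ∈ Subgroup.closure (range f), g x = y
  iseqv :=
    { refl := fun x => ⟨1, one_mem _, rfl⟩
      symm := by
        rintro x _ ⟨g, hg, rfl⟩
        exact ⟨g⁻¹, inv_mem hg, g.symm_apply_apply x⟩
      trans := by
        rintro x _ _ ⟨g, hg, rfl⟩ ⟨g', hg', rfl⟩
        exact ⟨g' * g, mul_mem hg' hg, rfl⟩ }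

theorem orbitSetoid_apply (f : Fin 3 → Torus ≃ₜ Torus) (j : Fin 3) (x : Torus) :
    orbitSetoid f x (f j x) :=
  ⟨f j, Subgroup.subset_closure (mem_range_self j), rfl⟩

theorem orbitSetoid_holonomy (f : Fin 3 → Torus ≃ₜ Torus) (ε : Bool) (j : Fin 3) (x : Torus) :
    orbitSetoid f x (holonomy f ε j x) := by
  cases ε
  · have := (orbitSetoid f).symm (orbitSetoid_apply f j ((f j).symm x))
    rwa [Homeomorph.apply_symm_apply] at this
  · exact orbitSetoid_apply f j x

namespace Suspension

variable (f : Fin 3 → Torus ≃ₜ Torus)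

/-- The holonomy orbit corresponding to a point of the suspension. -/
def orbit : Suspension f → Quotient (orbitSetoid f) :=
  Quotient.lift (s := gluing f) (fun p => Quotient.mk (orbitSetoid f) (torusMk p.2.2)) (by
    rintro ⟨ε, z, w⟩ ⟨ε', z', w'⟩ (⟨-, -, h⟩ | ⟨-, j, -, h⟩)
    · dsimp only at h ⊢
      rw [h]
    · dsimp only at h ⊢
      rw [h]
      exact Quotient.sound (orbitSetoid_holonomy f ε j _))

theorem orbit_param (ε : Bool) {p : Plane × Plane} (hp : p ∈ domain) :
    orbit f (param f ε p) = Quotient.mk (orbitSetoid f) (torusMk p.2) := by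
  rw [param_of_mem f ε hp]
  rfl

variable [IsSmoothMonodromy f]

theorem orbit_eq (b : Box) {x : Suspension f} (hx : x ∈ (boxChart f b).source) :
    orbit f x = Quotient.mk (orbitSetoid f) (torusMk (boxChart f b x).2) := by
  obtain ⟨p, hp, rfl⟩ := hx
  rw [boxChart_param f b hp, orbit_param f _ (b.carrier_subset_domain hp)]

/-- Along a plaque of any foliated chart the orbit is locally constant, and plaques are
connected. -/
theorem orbit_eq_of_plaque {e : OpenPartialHomeomorph (Suspension f) (FoliatedModel 2 2)}
    (he : e ∈ (foliation f).charts) {x x' : Suspension f} (hx : x ∈ e.source)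
    (hx' : x' ∈ e.source) (h : (e x).2 = (e x').2) : orbit f x = orbit f x' := by
  obtain ⟨-, -, a, r, c, s, -, -, ht⟩ := he.1
  have hy : (e x).2 ∈ Metric.ball c s := (ht ▸ e.map_source hx : e x ∈ _ ×ˢ _).2
  have hmem : ∀ u ∈ Metric.ball a r, (u, (e x).2) ∈ e.target := fun u hu => by
    rw [ht]; exact ⟨hu, hy⟩
  have hu : (e x).1 ∈ Metric.ball a r := (ht ▸ e.map_source hx : e x ∈ _ ×ˢ _).1
  have hu' : (e x').1 ∈ Metric.ball a r := (ht ▸ e.map_source hx' : e x' ∈ _ ×ˢ _).1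
  have key := (convex_ball a r).isPreconnected.induction₂
    (fun u u' => orbit f (e.symm (u, (e x).2)) = orbit f (e.symm (u', (e x).2)))
    (fun u hu => by
      obtain ⟨b, hb⟩ := exists_mem_boxChart_source f (e.symm (u, (e x).2))
      obtain ⟨γ, hγ⟩ := (he.2 b).1 _ ⟨e.map_target (hmem u hu), hb⟩
      have ht : Tendsto (fun u' => e.symm (u', (e x).2)) (𝓝 u) (𝓝 (e.symm (u, (e x).2))) :=
        ((e.symm.continuousAt (hmem u hu)).tendsto.comp
          (Continuous.prodMk continuous_id continuous_const).continuousAt)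
      have hev := hγ.and ((boxChart f b).open_source.mem_nhds hb)
      rw [orbit_eq f b hb, hγ.self_of_nhds, e.right_inv (hmem u hu)]
      filter_upwards [nhdsWithin_le_nhds (ht.eventually hev), self_mem_nhdsWithin] with u' h1 h2
      rw [orbit_eq f b h1.2, h1.1, e.right_inv (hmem u' h2)])
    (fun _ _ _ _ _ _ h1 h2 => h1.trans h2) (fun _ _ _ _ h1 => h1.symm) hu hu'
  rw [show ((e x).1, (e x).2) = e x from rfl, e.left_inv hx] at key
  rw [key, h, show ((e x').1, (e x').2) = e x' from rfl, e.left_inv hx']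

theorem orbit_eq_of_leaf {x x' : Suspension f} (h : (foliation f).leafSetoid x x') :
    orbit f x = orbit f x' := by
  induction h with
  | rel _ _ h =>
    obtain ⟨e, he, hx, hx', h⟩ := h
    exact orbit_eq_of_plaque f he hx hx' h
  | refl _ => rfl
  | symm _ _ _ h => exact h.symm
  | trans _ _ _ _ _ h h' => exact h.trans h'

theorem leaf_of_region (ε : Bool) (w : Plane) {z z' : Plane} (hz : z ∈ region)
    (hz' : z' ∈ region) : (foliation f).leafSetoid (param f ε (z, w)) (param f ε (z', w)) := by
  refine isConnected_region.isPreconnected.induction₂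
    (fun z z' => (foliation f).leafSetoid (param f ε (z, w)) (param f ε (z', w)))
    (fun z hz => ?_) (fun _ _ _ _ _ _ h1 h2 => (foliation f).leafSetoid.trans h1 h2)
    (fun _ _ _ _ h1 => (foliation f).leafSetoid.symm h1) hz hz'
  obtain ⟨b, rfl, hb⟩ := exists_box_of_mem hz ε w
  filter_upwards [nhdsWithin_le_nhds (Metric.isOpen_ball.mem_nhds hb.1)] with u hu
  have hu' : (u, w) ∈ b.carrier := ⟨hu, hb.2⟩
  refine Relation.EqvGen.rel _ _ ⟨_, boxChart_mem_charts f b, ⟨_, hb, rfl⟩, ⟨_, hu', rfl⟩, ?_⟩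
  rw [boxChart_param f b hb, boxChart_param f b hu']

/-- All the points over `x` and over `y` lie in the same leaf. -/
def LeafRelated (x y : Torus) : Prop :=
  ∀ ε ε' (p p' : Plane × Plane), p ∈ domain → p' ∈ domain → torusMk p.2 = x → torusMk p'.2 = y →
    (foliation f).leafSetoid (param f ε p) (param f ε' p')

variable {f}

theorem LeafRelated.symm {x y : Torus} (h : LeafRelated f x y) : LeafRelated f y x :=
  fun ε ε' p p' hp hp' hx hy => (foliation f).leafSetoid.symm (h ε' ε p' p hp' hp hy hx)

theorem LeafRelated.trans {x y z : Torus} (h : LeafRelated f x y) (h' : LeafRelated f y z) :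
    LeafRelated f x z := fun ε ε' p p' hp hp' hx hy => by
  obtain ⟨v, -, hv⟩ := exists_torusMk_eq y
  have hd : (p.1, v) ∈ domain := hp
  exact (foliation f).leafSetoid.trans (h ε true p (p.1, v) hp hd hx hv)
    (h' true ε' (p.1, v) p' hd hp' hv hy)

theorem leaf_of_torusMk_eq (ε : Bool) {p p' : Plane × Plane} (hp : p ∈ domain) (hp' : p' ∈ domain)
    (h : torusMk p.2 = torusMk p'.2) :
    (foliation f).leafSetoid (param f ε p) (param f ε p') := by
  have hd : (p'.1, p.2) ∈ domain := hp'
  have h1 := leaf_of_region f ε p.2 hp hp'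
  rwa [(param_eq_iff f hd hp').2 (Or.inl ⟨rfl, rfl, h.symm⟩)] at h1

theorem leaf_holonomy (ε : Bool) (j : Fin 3) {p p' : Plane × Plane} (hp : p ∈ domain)
    (hp' : p' ∈ domain) (h : torusMk p'.2 = holonomy f ε j (torusMk p.2)) :
    (foliation f).leafSetoid (param f ε p) (param f (!ε) p') := by
  obtain ⟨z, hz, hz'⟩ := exists_mem_reflect_mem j
  have h1 : (z, p.2) ∈ domain := hz
  have h2 : (reflect j z, p'.2) ∈ domain := hz'
  refine (foliation f).leafSetoid.trans (leaf_of_torusMk_eq ε hp h1 rfl) ?_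
  rw [(param_eq_iff f h1 h2).2 (Or.inr ⟨rfl, j, rfl, h⟩)]
  exact leaf_of_torusMk_eq (!ε) h2 hp' rfl

theorem LeafRelated.refl (h0 : f 0 = Homeomorph.refl _) (x : Torus) : LeafRelated f x x := by
  intro ε ε' p p' hp hp' hx hx'
  by_cases h : ε' = ε
  · subst h
    exact leaf_of_torusMk_eq ε' hp hp' (hx.trans hx'.symm)
  · obtain rfl : ε' = !ε := by cases ε <;> cases ε' <;> simp_all
    refine leaf_holonomy ε 0 hp hp' ?_
    rw [hx', hx]
    cases ε <;> simp [holonomy, h0]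

theorem LeafRelated.apply (h0 : f 0 = Homeomorph.refl _) (j : Fin 3) (x : Torus) :
    LeafRelated f x (f j x) := by
  intro ε ε' p p' hp hp' hx hx'
  refine (foliation f).leafSetoid.trans (LeafRelated.refl h0 x ε true p p hp hp hx hx) ?_
  refine (foliation f).leafSetoid.trans (leaf_holonomy true j hp hp' ?_)
    (LeafRelated.refl h0 _ _ ε' p' p' hp' hp' hx' hx')
  rw [hx', hx]
  rfl

theorem LeafRelated.of_orbit (h0 : f 0 = Homeomorph.refl _) {x y : Torus}
    (h : orbitSetoid f x y) : LeafRelated f x y := by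
  obtain ⟨g, hg, rfl⟩ := h
  induction hg using Subgroup.closure_induction generalizing x with
  | mem _ h =>
    obtain ⟨j, rfl⟩ := h
    exact LeafRelated.apply h0 j x
  | one => exact LeafRelated.refl h0 x
  | mul g g' _ _ h h' => exact h'.trans h
  | inv g _ h =>
    have := (h (x := g⁻¹ x)).symm
    rwa [show g (g⁻¹ x) = x from g.apply_symm_apply x] at this

variable (f)

/-! ### A regular atlas of the suspension -/

theorem exists_radius {z : Plane} (hz : z ∈ region) :
    ∃ r : ℝ, 0 < r ∧ r ≤ 1 / 4 ∧ Metric.ball z (2 * r) ⊆ region := by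
  obtain ⟨r, hr, h⟩ := Metric.isOpen_iff.1 isOpen_region z hz
  refine ⟨min (r / 2) (1 / 4), by positivity, min_le_right _ _, ?_⟩
  exact (Metric.ball_subset_ball (by linarith [min_le_left (r / 2) (1 / 4)])).trans h

/-- The radius of the small disc used in the regular atlas. -/
noncomputable def smallRadius (p : domain) : ℝ := (exists_radius p.2).choose

theorem smallRadius_pos (p : domain) : 0 < smallRadius p := (exists_radius p.2).choose_spec.1

theorem smallRadius_le (p : domain) : smallRadius p ≤ 1 / 4 := (exists_radius p.2).choose_spec.2.1

theorem ball_subset_region (p : domain) : Metric.ball p.1.1 (2 * smallRadius p) ⊆ region :=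
  (exists_radius p.2).choose_spec.2.2

/-- The box around a point used in the regular atlas. -/
noncomputable def smallBox (ε : Bool) (p : domain) : Box where
  sheet := ε
  leafCenter := p.1.1
  leafRadius := smallRadius p
  transCenter := p.1.2
  transRadius := 1 / 4
  leafRadius_pos := smallRadius_pos p
  transRadius_pos := by norm_num
  transRadius_le := by norm_num
  subset_region := (Metric.ball_subset_ball (by linarith [smallRadius_pos p])).trans
    (ball_subset_region p)

/-- A box containing the closure of the small box. -/
noncomputable def largeBox (ε : Bool) (p : domain) : Box where
  sheet := ε
  leafCenter := p.1.1
  leafRadius := 2 * smallRadius p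
  transCenter := p.1.2
  transRadius := 1 / 2
  leafRadius_pos := by linarith [smallRadius_pos p]
  transRadius_pos := by norm_num
  transRadius_le := le_rfl
  subset_region := ball_subset_region p

theorem closure_smallBox_source [T2Space (Suspension f)] (ε : Bool) (p : domain) :
    closure (boxChart f (smallBox ε p)).source ⊆ (boxChart f (largeBox ε p)).source := by
  have hsub : Metric.closedBall p.1.1 (smallRadius p) ×ˢ Metric.closedBall p.1.2 (1 / 4) ⊆
      (largeBox ε p).carrier :=
    prod_mono (Metric.closedBall_subset_ball (by
        change _ < 2 * smallRadius p; linarith [smallRadius_pos p]))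
      (Metric.closedBall_subset_ball (by change _ < (1 / 2 : ℝ); norm_num))
  have hc : IsCompact (param f ε ''
      (Metric.closedBall p.1.1 (smallRadius p) ×ˢ Metric.closedBall p.1.2 (1 / 4))) :=
    ((isCompact_closedBall _ _).prod (isCompact_closedBall _ _)).image_of_continuousOn
      ((continuousOn_param f ε).mono (hsub.trans (Box.carrier_subset_domain _)))
  refine (closure_minimal (image_mono ?_) hc.isClosed).trans (image_mono hsub)
  exact prod_mono Metric.ball_subset_closedBall Metric.ball_subset_closedBall

theorem exists_finset_cover : ∃ t : Finset domain,
    fundamental ⊆ ⋃ p ∈ t, (smallBox true p).carrier := by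
  refine isCompact_fundamental.elim_finite_subcover (fun p : domain => (smallBox true p).carrier)
    (fun p => Box.isOpen_carrier _) fun p hp => mem_iUnion.2 ⟨⟨p, fundamental_subset_domain hp⟩, ?_⟩
  exact ⟨Metric.mem_ball_self (smallRadius_pos _), Metric.mem_ball_self (by norm_num [smallBox])⟩

/-- The indices of the charts of the regular atlas. -/
abbrev AtlasIndex : Type := Bool × exists_finset_cover.choose

/-- The boxes of the regular atlas. -/
noncomputable def atlasBox (i : Fin (Fintype.card AtlasIndex)) : Box :=
  smallBox ((Fintype.equivFin AtlasIndex).symm i).1 ((Fintype.equivFin AtlasIndex).symm i).2.1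

theorem exists_atlasBox (ε : Bool) {p : Plane × Plane} (hp : p ∈ fundamental) :
    ∃ i, (atlasBox i).sheet = ε ∧ p ∈ (atlasBox i).carrier := by
  obtain ⟨u, hu, h⟩ := mem_iUnion₂.1 (exists_finset_cover.choose_spec hp)
  refine ⟨Fintype.equivFin AtlasIndex (ε, ⟨u, hu⟩), ?_, ?_⟩ <;>
    simp only [atlasBox, Equiv.symm_apply_apply]
  · rfl
  · exact h

variable {f}

/-- The holonomy between two small boxes is the restriction of a single homeomorphism of the
torus, since a small box meets the collar of one gluing circle at most. -/
theorem exists_box_holonomy (b b' : Box) (hb : b.leafRadius ≤ 1 / 4) :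
    ∃ H : Torus ≃ₜ Torus, (H = Homeomorph.refl _ ∨ ∃ ε j, H = holonomy f ε j) ∧
      ∀ x ∈ (boxChart f b).source ∩ (boxChart f b').source,
        torusMk (boxChart f b' x).2 = H (torusMk (boxChart f b x).2) := by
  by_cases hs : b'.sheet = b.sheet
  · refine ⟨Homeomorph.refl _, Or.inl rfl, ?_⟩
    rintro x ⟨⟨p, hp, rfl⟩, ⟨p', hp', he⟩⟩
    rw [boxChart_param f b hp, ← he, boxChart_param f b' hp']
    rcases (param_eq_iff f (b.carrier_subset_domain hp) (b'.carrier_subset_domain hp')).1 he.symm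
      with ⟨-, -, h⟩ | ⟨h, -⟩
    · exact h
    · simp [hs] at h
  · have key : ∀ p ∈ b.carrier, ∀ p' ∈ b'.carrier, param f b.sheet p = param f b'.sheet p' →
        ∃ j, p'.1 = reflect j p.1 ∧ torusMk p'.2 = holonomy f b.sheet j (torusMk p.2) :=
      fun p hp p' hp' he => by
        rcases (param_eq_iff f (b.carrier_subset_domain hp) (b'.carrier_subset_domain hp')).1 he
          with ⟨h, -⟩ | ⟨-, h⟩
        · exact absurd h hs
        · exact h
    by_cases hn : ((boxChart f b).source ∩ (boxChart f b').source).Nonempty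
    · obtain ⟨x, ⟨p, hp, rfl⟩, ⟨p', hp', he⟩⟩ := hn
      obtain ⟨j, hj, -⟩ := key p hp p' hp' he.symm
      refine ⟨holonomy f b.sheet j, Or.inr ⟨_, _, rfl⟩, ?_⟩
      rintro y ⟨⟨u, hu, rfl⟩, ⟨u', hu', he'⟩⟩
      obtain ⟨k, hk, hk'⟩ := key u hu u' hu' he'.symm
      have hd : dist p.1 u.1 < 1 := by
        have h1 := Metric.mem_ball.1 hp.1
        have h2 := Metric.mem_ball.1 hu.1
        linarith [dist_triangle_right p.1 u.1 b.leafCenter]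
      obtain rfl := reflect_index_unique (b.subset_region hp.1) (b.subset_region hu.1) hd
        (hj ▸ b'.subset_region hp'.1) (hk ▸ b'.subset_region hu'.1)
      rw [boxChart_param f b hu, ← he', boxChart_param f b' hu', hk']
    · refine ⟨Homeomorph.refl _, Or.inl rfl, fun x hx => absurd ⟨x, hx⟩ hn⟩

theorem eq_of_mem_smallBox {ε : Bool} {p : domain} {x x' : Plane × Plane}
    (hx : x ∈ (smallBox ε p).carrier) (hx' : x' ∈ (smallBox ε p).carrier)
    (h : torusMk x.2 = torusMk x'.2) : x.2 = x'.2 := by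
  refine eq_of_torusMk_eq h ?_
  have h1 : dist x.2 p.1.2 < 1 / 4 := hx.2
  have h2 : dist x'.2 p.1.2 < 1 / 4 := hx'.2
  linarith [dist_triangle_right x.2 x'.2 p.1.2]

variable (f)

theorem boxHolonomy_exists (i j : Fin (Fintype.card AtlasIndex)) :
    ∃ H : Torus ≃ₜ Torus, (H = Homeomorph.refl _ ∨ ∃ ε j, H = holonomy f ε j) ∧
      ∀ x ∈ (boxChart f (atlasBox i)).source ∩ (boxChart f (atlasBox j)).source,
        torusMk (boxChart f (atlasBox j) x).2 = H (torusMk (boxChart f (atlasBox i) x).2) :=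
  exists_box_holonomy _ _ (smallRadius_le _)

/-- The regular atlas of the suspension formed by small boxes. -/
noncomputable def regularAtlas [T2Space (Suspension f)] : (foliation f).RegularAtlas where
  size := Fintype.card AtlasIndex
  chart i := boxChart f (atlasBox i)
  mem_charts i := boxChart_mem_charts f _
  cover x := by
    obtain ⟨ε, p, hp, rfl⟩ := exists_mem_fundamental x
    obtain ⟨i, rfl, hi⟩ := exists_atlasBox ε hp
    exact ⟨i, p, hi, rfl⟩
  closure_compact i :=
    haveI := compactSpace (f := f)
    isClosed_closure.isCompact
  closure_subset i := ⟨_, boxChart_mem_charts f _, closure_smallBox_source f _ _⟩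
  plaque_unique i j x hx x' hx' h := by
    obtain ⟨H, -, hH⟩ := boxHolonomy_exists f i j
    have := (hH x hx).trans ((congrArg (fun v => H (torusMk v)) h).trans (hH x' hx').symm)
    exact eq_of_mem_smallBox ((boxChart f (atlasBox j)).map_source hx.2)
      ((boxChart f (atlasBox j)).map_source hx'.2) this

variable [T2Space (Suspension f)]

/-- The projection of the total transversal to the torus. -/
def toTorus (s : (regularAtlas f).Transversal) : Torus := torusMk s.2.1

theorem continuous_toTorus_mk (i : Fin (regularAtlas f).size) :
    Continuous fun y : (regularAtlas f).LocalTransversal i => toTorus f ⟨i, y⟩ :=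
  continuous_torusMk.comp continuous_subtype_val

theorem injective_toTorus_mk (i : Fin (regularAtlas f).size) :
    Function.Injective fun y : (regularAtlas f).LocalTransversal i => toTorus f ⟨i, y⟩ := by
  rintro ⟨_, p, hp, rfl⟩ ⟨_, p', hp', rfl⟩ h
  exact Subtype.ext (eq_of_mem_smallBox hp hp' h)

theorem isOpen_localTransversal (i : Fin (regularAtlas f).size) :
    IsOpen (Prod.snd '' ((regularAtlas f).chart i).target) :=
  isOpenMap_snd _ ((regularAtlas f).chart i).open_target

theorem surjective_toTorus : Function.Surjective (toTorus f) := by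
  intro x
  obtain ⟨v, hv, rfl⟩ := exists_torusMk_eq x
  obtain ⟨z, hz⟩ := isConnected_region.nonempty
  have hc : core.Nonempty := by
    by_cases h : z ∈ core
    · exact ⟨z, h⟩
    · obtain ⟨j, hj⟩ := exists_reflect_mem_core hz h
      exact ⟨_, hj⟩
  obtain ⟨z, hz⟩ := hc
  obtain ⟨i, -, hi⟩ := exists_atlasBox true (p := (z, v)) ⟨hz, hv⟩
  exact ⟨⟨i, v, (z, v), hi, rfl⟩, rfl⟩

theorem exists_adj_holonomy (i j : Fin (regularAtlas f).size) :
    ∃ H : Torus ≃ₜ Torus, (H = Homeomorph.refl _ ∨ ∃ ε j, H = holonomy f ε j) ∧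
      ∀ y z, (regularAtlas f).Adj ⟨i, y⟩ ⟨j, z⟩ → toTorus f ⟨j, z⟩ = H (toTorus f ⟨i, y⟩) := by
  obtain ⟨H, hH, h⟩ := boxHolonomy_exists f i j
  refine ⟨H, hH, ?_⟩
  rintro y z ⟨x, ⟨hx, hy⟩, ⟨hx', hz⟩⟩
  have := h x ⟨hx, hx'⟩
  change torusMk z.1 = H (torusMk y.1)
  rw [← hy, ← hz]
  exact this

theorem exists_param_of_mem_plaque {s : (regularAtlas f).Transversal} {x : Suspension f}
    (hx : x ∈ (regularAtlas f).plaque s) :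
    ∃ ε, ∃ p ∈ domain, param f ε p = x ∧ torusMk p.2 = toTorus f s := by
  obtain ⟨⟨p, hp, rfl⟩, h⟩ := hx
  refine ⟨_, p, Box.carrier_subset_domain _ hp, rfl, ?_⟩
  rw [← boxChart_param f _ hp]
  exact congrArg torusMk h

/-- Leaves correspond to holonomy orbits. -/
theorem rel_iff (h0 : f 0 = Homeomorph.refl _) (s t : (regularAtlas f).Transversal) :
    (regularAtlas f).rel s t ↔ orbitSetoid f (toTorus f s) (toTorus f t) := by
  constructor
  · rintro ⟨x, hx, x', hx', h⟩
    obtain ⟨ε, p, hp, rfl, hps⟩ := exists_param_of_mem_plaque f hx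
    obtain ⟨ε', p', hp', rfl, hpt⟩ := exists_param_of_mem_plaque f hx'
    have := orbit_eq_of_leaf f h
    rw [orbit_param f ε hp, orbit_param f ε' hp', hps, hpt] at this
    exact Quotient.exact this
  · intro h
    obtain ⟨x, hx⟩ := (regularAtlas f).plaque_nonempty s
    obtain ⟨x', hx'⟩ := (regularAtlas f).plaque_nonempty t
    obtain ⟨ε, p, hp, rfl, hps⟩ := exists_param_of_mem_plaque f hx
    obtain ⟨ε', p', hp', rfl, hpt⟩ := exists_param_of_mem_plaque f hx'
    exact ⟨_, hx, _, hx', LeafRelated.of_orbit h0 h ε ε' p p' hp hp' hps hpt⟩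

end Suspension

end Pants

/-! ### Forests in amenable equivalence relations -/

/-- An amenable system of means for an equivalence relation: for almost every point a finitely
additive probability measure on its class, which only depends on the class, and is measurable along
measurable sets of pairs. -/
structure Setoid.IsMeanSystem {X : Type*} [MeasurableSpace X] (r : Setoid X) (μ : Measure X)
    (m : X → Set X → ℝ) : Prop where
  ae_mean : ∀ᵐ x ∂μ, (∀ S, 0 ≤ m x S) ∧
    (∀ S S', Disjoint S S' → m x (S ∪ S') = m x S + m x S') ∧
    m x univ = 1 ∧ m x {z | r x z} = 1 ∧ ∀ z, r x z → m z = m x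
  aemeasurable : ∀ E : Set (X × X), MeasurableSet E → AEMeasurable (fun x => m x {z | (x, z) ∈ E}) μ

namespace PartialForest

variable {X α : Type*} (ρ : FreeGroup α →* Equiv.Perm X) (D : α → Set X)

/-- The step of a walk given by a letter: the inverse of its action. With this convention, the walk
along a word leads to the image of the starting point under the inverse of the word. -/
def step (s : α × Bool) : Equiv.Perm X := (ρ (FreeGroup.mk [s]))⁻¹

/-- The set of points at which the edge of the forest given by a letter exists: the points `x` and
`ρ a x` are joined by an edge if `x ∈ D a`. -/
def dom (s : α × Bool) : Set X := if s.2 then (step ρ s) ⁻¹' D s.1 else D s.1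

/-- The end point of the walk along a word. -/
def walk : List (α × Bool) → X → X
  | [], x => x
  | s :: L, x => walk L (step ρ s x)

/-- All the steps of the walk along a word are edges of the forest. -/
def IsWalk : List (α × Bool) → X → Prop
  | [], _ => True
  | s :: L, x => x ∈ dom ρ D s ∧ IsWalk L (step ρ s x)

/-- The letter of the reversed edge. -/
def flip (s : α × Bool) : α × Bool := (s.1, !s.2)

/-- The connected component of the forest containing a point. -/
def component (x : X) : Set X :=
  {p | ∃ L, FreeGroup.IsReduced L ∧ IsWalk ρ D L x ∧ walk ρ L x = p}

/-- The points of the component of `x` which lie behind the edge at `x` given by a letter. -/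
def branch (s : α × Bool) (x : X) : Set X :=
  {p | ∃ L, FreeGroup.IsReduced (s :: L) ∧ IsWalk ρ D (s :: L) x ∧ walk ρ (s :: L) x = p}

theorem walk_eq (L : List (α × Bool)) (x : X) : walk ρ L x = (ρ (FreeGroup.mk L))⁻¹ x := by
  induction L generalizing x with
  | nil =>
    rw [← FreeGroup.one_eq_mk, map_one]
    rfl
  | cons s L ih =>
    rw [walk, ih, step, show FreeGroup.mk (s :: L) = FreeGroup.mk [s] * FreeGroup.mk L by
      rw [FreeGroup.mul_mk]; rfl, map_mul, mul_inv_rev]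
    rfl

theorem step_flip (s : α × Bool) : step ρ (flip s) = (step ρ s)⁻¹ := by
  rw [step, step, ← map_inv, ← map_inv, ← map_inv, FreeGroup.inv_mk, FreeGroup.inv_mk,
    FreeGroup.inv_mk]
  simp [FreeGroup.invRev, flip]

theorem step_flip_step (s : α × Bool) (x : X) : step ρ (flip s) (step ρ s x) = x := by
  rw [step_flip]
  exact (step ρ s).symm_apply_apply x

theorem mem_dom_flip (s : α × Bool) (x : X) : step ρ s x ∈ dom ρ D (flip s) ↔ x ∈ dom ρ D s := by
  obtain ⟨a, ε⟩ := s
  cases ε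
  · have := step_flip_step ρ (a, false) x
    simp only [flip, Bool.not_false] at this
    simp [dom, flip, this]
  · simp [dom, flip]

theorem branch_subset_component (s : α × Bool) (x : X) : branch ρ D s x ⊆ component ρ D x := by
  rintro p ⟨L, h⟩
  exact ⟨_, h⟩

theorem mem_component_self (x : X) : x ∈ component ρ D x :=
  ⟨[], by simp [FreeGroup.IsReduced], trivial, rfl⟩

theorem branch_subset_component_step (s : α × Bool) (x : X) :
    branch ρ D s x ⊆ component ρ D (step ρ s x) := by
  rintro p ⟨L, hL, h, rfl⟩
  exact ⟨L, hL.of_cons, h.2, rfl⟩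

/-- The two sides of an edge cover the whole component. -/
theorem component_subset (s : α × Bool) {x : X} (hx : x ∈ dom ρ D s) :
    component ρ D x ⊆ branch ρ D s x ∪ branch ρ D (flip s) (step ρ s x) := by
  rintro p ⟨L, hL, h, rfl⟩
  have hw : IsWalk ρ D (flip s :: L) (step ρ s x) := by
    refine ⟨(mem_dom_flip ρ D s x).2 hx, ?_⟩
    rwa [step_flip_step]
  have he : walk ρ (flip s :: L) (step ρ s x) = walk ρ L x := by rw [walk, step_flip_step]
  by_cases hs : FreeGroup.IsReduced (flip s :: L)
  · exact Or.inr ⟨L, hs, hw, he⟩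
  · cases L with
    | nil => simp at hs
    | cons t L =>
      have hts : t = s := by
        rw [FreeGroup.isReduced_cons_cons, not_and_or] at hs
        rcases hs with hs | hs
        · rw [Classical.not_imp] at hs
          refine Prod.ext hs.1.symm ?_
          have h2 : (!s.2) ≠ t.2 := hs.2
          revert h2
          cases s.2 <;> cases t.2 <;> simp
        · exact absurd hL hs
      subst hts
      exact Or.inl ⟨L, hL, h, rfl⟩

theorem component_step (s : α × Bool) {x : X} (hx : x ∈ dom ρ D s) :
    component ρ D (step ρ s x) = component ρ D x := by
  have key : ∀ s : α × Bool, ∀ x, x ∈ dom ρ D s → component ρ D x ⊆ component ρ D (step ρ s x) :=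
    fun s x hx p hp => by
      rcases component_subset ρ D s hx hp with h | h
      · exact branch_subset_component_step ρ D s x h
      · exact branch_subset_component ρ D _ _ h
  refine (key s x hx).antisymm' ?_
  have := key (flip s) (step ρ s x) ((mem_dom_flip ρ D s x).2 hx)
  rwa [step_flip_step] at this

/-- At a point with trivial stabilizer the branches along different edges are disjoint. -/
theorem branch_index_unique {x : X} (hx : ∀ g : FreeGroup α, g ≠ 1 → ρ g x ≠ x) {s t : α × Bool}
    {p : X} (hs : p ∈ branch ρ D s x) (ht : p ∈ branch ρ D t x) : s = t := by
  obtain ⟨L, hL, -, rfl⟩ := hs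
  obtain ⟨L', hL', -, h⟩ := ht
  rw [walk_eq, walk_eq, ← map_inv, ← map_inv] at h
  have hg : FreeGroup.mk (s :: L) = FreeGroup.mk (t :: L') := by
    by_contra hne
    refine hx (FreeGroup.mk (t :: L') * (FreeGroup.mk (s :: L))⁻¹) ?_ ?_
    · rw [Ne, mul_inv_eq_one]
      exact fun h => hne h.symm
    · rw [map_mul, Equiv.Perm.mul_apply, ← h, ← Equiv.Perm.mul_apply, ← map_mul, mul_inv_cancel,
        map_one, Equiv.Perm.one_apply]
  classical
  have h2 := FreeGroup.reduce.sound hg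
  rw [hL.reduce_eq, hL'.reduce_eq] at h2
  exact (List.cons.inj h2).1

variable (θ : ℕ → X → X)

/-- The points which are sent behind the edge at `x` given by a letter by the retraction to the
component of `x`; the retraction maps `z` to the first of the points `θ 0 z, θ 1 z, …` which
belongs to the component. -/
def side (s : α × Bool) (x : X) : Set X :=
  {z | x ∈ dom ρ D s ∧ ∃ n, θ n z ∈ branch ρ D s x ∧ ∀ k < n, θ k z ∉ component ρ D x}

theorem side_disjoint {x : X} (hx : ∀ g : FreeGroup α, g ≠ 1 → ρ g x ≠ x) {s t : α × Bool}
    (hst : s ≠ t) : Disjoint (side ρ D θ s x) (side ρ D θ t x) := by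
  rw [Set.disjoint_left]
  rintro z ⟨-, n, hn, hn'⟩ ⟨-, k, hk, hk'⟩
  have h : n = k := by
    rcases lt_trichotomy n k with h | h | h
    · exact absurd (branch_subset_component ρ D s x hn) (hk' n h)
    · exact h
    · exact absurd (branch_subset_component ρ D t x hk) (hn' k h)
  subst h
  exact hst (branch_index_unique ρ D hx hn hk)

theorem class_subset_side {r : Setoid X} (hθ : ∀ x y, r x y → ∃ n, θ n x = y) (s : α × Bool) {x : X}
    (hx : x ∈ dom ρ D s) : {z | r x z} ⊆ side ρ D θ s x ∪ side ρ D θ (flip s) (step ρ s x) := by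
  classical
  intro z hz
  have hex : ∃ n, θ n z ∈ component ρ D x := by
    obtain ⟨n, hn⟩ := hθ z x (r.symm hz)
    exact ⟨n, by rw [hn]; exact mem_component_self ρ D x⟩
  have h1 := Nat.find_spec hex
  have h2 : ∀ k < Nat.find hex, θ k z ∉ component ρ D x := fun k hk => Nat.find_min hex hk
  rcases component_subset ρ D s hx h1 with h | h
  · exact Or.inl ⟨hx, _, h, h2⟩
  · refine Or.inr ⟨(mem_dom_flip ρ D s x).2 hx, _, h, ?_⟩
    rwa [component_step ρ D s hx]

section Measurable

variable [MeasurableSpace X]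

theorem measurable_step (hρ : ∀ g, Measurable (ρ g)) (s : α × Bool) : Measurable (step ρ s) := by
  rw [step, ← map_inv]
  exact hρ _

theorem measurableSet_dom (hρ : ∀ g, Measurable (ρ g)) (hD : ∀ a, MeasurableSet (D a))
    (s : α × Bool) : MeasurableSet (dom ρ D s) := by
  rw [dom]
  split_ifs
  · exact measurable_step ρ hρ s (hD _)
  · exact hD _

theorem measurableSet_isWalk (hρ : ∀ g, Measurable (ρ g)) (hD : ∀ a, MeasurableSet (D a))
    (L : List (α × Bool)) : MeasurableSet {x | IsWalk ρ D L x} := by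
  induction L with
  | nil => exact MeasurableSet.univ
  | cons s L ih => exact (measurableSet_dom ρ D hρ hD s).inter (measurable_step ρ hρ s ih)

theorem measurable_walk (hρ : ∀ g, Measurable (ρ g)) (L : List (α × Bool)) :
    Measurable (walk ρ L) := by
  induction L with
  | nil => exact measurable_id
  | cons s L ih => exact ih.comp (measurable_step ρ hρ s)

variable [Countable α] [TopologicalSpace X] [BorelSpace X] [SecondCountableTopology X] [T2Space X]

theorem measurableSet_walk_eq (hρ : ∀ g, Measurable (ρ g)) (hD : ∀ a, MeasurableSet (D a))
    {φ : X → X} (hφ : Measurable φ) (P : List (α × Bool) → Prop) :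
    MeasurableSet {q : X × X | ∃ L, P L ∧ IsWalk ρ D L q.1 ∧ walk ρ L q.1 = φ q.2} := by
  have : {q : X × X | ∃ L, P L ∧ IsWalk ρ D L q.1 ∧ walk ρ L q.1 = φ q.2} =
      ⋃ L, ⋃ _ : P L, {q : X × X | IsWalk ρ D L q.1} ∩ {q | walk ρ L q.1 = φ q.2} := by
    ext q
    simp [and_left_comm]
  rw [this]
  refine MeasurableSet.iUnion fun L => MeasurableSet.iUnion fun _ => ?_
  exact (measurable_fst (measurableSet_isWalk ρ D hρ hD L)).inter
    (measurableSet_eq_fun ((measurable_walk ρ hρ L).comp measurable_fst) (hφ.comp measurable_snd))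

theorem measurableSet_side (hρ : ∀ g, Measurable (ρ g)) (hD : ∀ a, MeasurableSet (D a))
    (hθ : ∀ n, Measurable (θ n)) (s : α × Bool) :
    MeasurableSet {q : X × X | q.2 ∈ side ρ D θ s q.1} := by
  have h1 : ∀ n, MeasurableSet {q : X × X | θ n q.2 ∈ branch ρ D s q.1} := fun n => by
    convert measurableSet_walk_eq ρ D hρ hD (hθ n)
      (fun L => ∃ L', L = s :: L' ∧ FreeGroup.IsReduced L) using 1
    ext q
    constructor
    · rintro ⟨L, h, h'⟩
      exact ⟨_, ⟨L, rfl, h⟩, h'⟩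
    · rintro ⟨_, ⟨L, rfl, h⟩, h'⟩
      exact ⟨L, h, h'⟩
  have h2 : ∀ n, MeasurableSet {q : X × X | θ n q.2 ∈ component ρ D q.1} := fun n =>
    measurableSet_walk_eq ρ D hρ hD (hθ n) FreeGroup.IsReduced
  have : {q : X × X | q.2 ∈ side ρ D θ s q.1} = {q | q.1 ∈ dom ρ D s} ∩
      ⋃ n, {q : X × X | θ n q.2 ∈ branch ρ D s q.1} ∩
        ⋂ k, ⋂ _ : k < n, {q : X × X | θ k q.2 ∈ component ρ D q.1}ᶜ := by
    ext q
    simp [side]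
  rw [this]
  exact (measurable_fst (measurableSet_dom ρ D hρ hD s)).inter (MeasurableSet.iUnion fun n =>
    (h1 n).inter (MeasurableSet.iInter fun k => MeasurableSet.iInter fun _ => (h2 k).compl))

end Measurable

theorem sum_le_one_of_disjoint {ι : Type*} {m : Set X → ℝ} (h0 : ∀ S, 0 ≤ m S)
    (hadd : ∀ S S', Disjoint S S' → m (S ∪ S') = m S + m S') (h1 : m univ = 1) (t : Finset ι)
    {B : ι → Set X} (hB : ∀ i j, i ≠ j → Disjoint (B i) (B j)) : ∑ i ∈ t, m (B i) ≤ 1 := by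
  classical
  have he : m ∅ = 0 := by
    have := hadd ∅ ∅ (by simp)
    rw [Set.union_self] at this
    linarith
  have key : ∑ i ∈ t, m (B i) = m (⋃ i ∈ t, B i) := by
    induction t using Finset.induction_on with
    | empty => simp [he]
    | insert i t hi ih =>
      rw [Finset.sum_insert hi, Finset.set_biUnion_insert, hadd, ih]
      rw [Set.disjoint_iUnion₂_right]
      exact fun j hj => hB _ _ (by rintro rfl; exact hi hj)
  have h2 := hadd _ _ (disjoint_compl_right (a := ⋃ i ∈ t, B i))
  rw [Set.union_compl_self, h1] at h2
  linarith [h0 (⋃ i ∈ t, B i)ᶜ]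

theorem le_add_of_subset_union {m : Set X → ℝ} (h0 : ∀ S, 0 ≤ m S)
    (hadd : ∀ S S', Disjoint S S' → m (S ∪ S') = m S + m S') {C S S' : Set X}
    (h : C ⊆ S ∪ S') : m C ≤ m S + m S' := by
  have hmono : ∀ {A B : Set X}, A ⊆ B → m A ≤ m B := fun {A B} hAB => by
    have := hadd A (B \ A) disjoint_sdiff_right
    rw [Set.union_sdiff_cancel hAB] at this
    linarith [h0 (B \ A)]
  have h1 := hadd S (S' \ S) disjoint_sdiff_right
  rw [Set.union_sdiff_self] at h1
  linarith [hmono h, hmono (Set.sdiff_subset (s := S') (t := S))]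

/-- In an equivalence relation with an amenable system of means, a forest formed by restrictions of
the generators of an essentially free measure-preserving action of a free group has at most as many
edges as vertices, on average. Indeed the sides of the edges at a vertex are disjoint, hence the sum
of their means is at most `1`, whereas the means of the two sides of an edge sum up to `1`. -/
theorem sum_measureReal_le_one [MeasurableSpace X] [Fintype α] [TopologicalSpace X] [BorelSpace X]
    [SecondCountableTopology X] [T2Space X] (μ : Measure X) [IsProbabilityMeasure μ]
    (hρ : ∀ g, MeasurePreserving (ρ g) μ μ) (hD : ∀ a, MeasurableSet (D a))
    (hfree : ∀ᵐ x ∂μ, ∀ g : FreeGroup α, g ≠ 1 → ρ g x ≠ x)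
    {r : Setoid X} (hθ : ∀ n, Measurable (θ n)) (hr : ∀ x y, r x y → ∃ n, θ n x = y)
    (hDr : ∀ a, ∀ x ∈ D a, r x (ρ (FreeGroup.of a) x))
    {m : X → Set X → ℝ} (hm : r.IsMeanSystem μ m) : ∑ a, μ.real (D a) ≤ 1 := by
  have hρm : ∀ g, Measurable (ρ g) := fun g => (hρ g).measurable
  have hstep : ∀ s, MeasurePreserving (step ρ s) μ μ := fun s => by
    rw [step, ← map_inv]
    exact hρ _
  have hdom : ∀ s : α × Bool, ∀ x ∈ dom ρ D s, r x (step ρ s x) := by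
    rintro ⟨a, ε⟩ x hx
    cases ε
    · have h1 : step ρ (a, false) = ρ (FreeGroup.of a) := by
        rw [step, ← map_inv, FreeGroup.inv_mk]
        rfl
      rw [h1]
      exact hDr a x hx
    · have h1 : step ρ (a, true) = (ρ (FreeGroup.of a))⁻¹ := rfl
      have h2 := hDr a _ (show step ρ (a, true) x ∈ D a from hx)
      rw [h1] at h2 ⊢
      rw [show ρ (FreeGroup.of a) ((ρ (FreeGroup.of a))⁻¹ x) = x from
        (ρ (FreeGroup.of a)).apply_symm_apply x] at h2
      exact r.symm h2
  set h : α × Bool → X → ℝ := fun s x => m x (side ρ D θ s x) with hh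
  have haem : ∀ s, AEMeasurable (h s) μ := fun s =>
    hm.aemeasurable _ (measurableSet_side ρ D θ hρm hD hθ s)
  have hsum : ∀ᵐ x ∂μ, ∑ s, h s x ≤ 1 := by
    filter_upwards [hm.ae_mean, hfree] with x hx hf
    exact sum_le_one_of_disjoint hx.1 hx.2.1 hx.2.2.1 _ fun s t hst => side_disjoint ρ D θ hf hst
  have hnonneg : ∀ᵐ x ∂μ, ∀ s, 0 ≤ h s x := by
    filter_upwards [hm.ae_mean] with x hx s
    exact hx.1 _
  have hle : ∀ s, ∀ᵐ x ∂μ, h s x ≤ 1 := fun s => by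
    filter_upwards [hsum, hnonneg] with x h1 h2
    exact (Finset.single_le_sum (fun t _ => h2 t) (Finset.mem_univ s)).trans h1
  have hint : ∀ s, Integrable (h s) μ := fun s => by
    refine Integrable.of_bound (haem s).aestronglyMeasurable 1 ?_
    filter_upwards [hle s, hnonneg] with x h1 h2
    rw [Real.norm_eq_abs, abs_of_nonneg (h2 s)]
    exact h1
  have hint' : ∀ s t, Integrable (fun x => h t (step ρ s x)) μ := fun s t =>
    (hstep s).integrable_comp_of_integrable (hint t)
  have hcov : ∀ s, ∀ᵐ x ∂μ,
      (dom ρ D s).indicator (fun _ => (1 : ℝ)) x ≤ h s x + h (flip s) (step ρ s x) := fun s => by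
    filter_upwards [hm.ae_mean, (hstep s).quasiMeasurePreserving.ae hnonneg, hnonneg]
      with x hx h1 h2
    by_cases hxs : x ∈ dom ρ D s
    · rw [indicator_of_mem hxs, ← hx.2.2.2.1]
      have := le_add_of_subset_union hx.1 hx.2.1 (class_subset_side ρ D θ hr s hxs)
      change _ ≤ m x _ + m (step ρ s x) _
      rwa [hx.2.2.2.2 _ (hdom s x hxs)]
    · rw [indicator_of_notMem hxs]
      exact add_nonneg (h2 s) (h1 _)
  have hedge : ∀ s, μ.real (dom ρ D s) ≤ ∫ x, h s x ∂μ + ∫ x, h (flip s) x ∂μ := fun s => by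
    have h1 := integral_mono_ae (integrable_const (μ := μ) (1 : ℝ) |>.indicator
      (measurableSet_dom ρ D hρm hD s)) ((hint s).add (hint' s (flip s))) (hcov s)
    rw [integral_indicator_const _ (measurableSet_dom ρ D hρm hD s), smul_eq_mul, mul_one] at h1
    have h2 : ∫ x, h (flip s) (step ρ s x) ∂μ = ∫ x, h (flip s) x ∂μ := by
      have h3 := (hstep s).map_eq
      conv_rhs => rw [← h3]
      rw [integral_map (hstep s).measurable.aemeasurable]
      rw [h3]
      exact (haem _).aestronglyMeasurable
    have h4 := integral_add (hint s) (hint' s (flip s))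
    calc μ.real (dom ρ D s) ≤ _ := h1
      _ = _ := by rw [← h2, ← h4]; rfl
  calc ∑ a, μ.real (D a) ≤ ∑ a, (∫ x, h (a, false) x ∂μ + ∫ x, h (a, true) x ∂μ) :=
        Finset.sum_le_sum fun a _ => hedge (a, false)
    _ = ∑ s, ∫ x, h s x ∂μ := by
        rw [Fintype.sum_prod_type]
        refine Finset.sum_congr rfl fun a _ => ?_
        simp [add_comm]
    _ = ∫ x, ∑ s, h s x ∂μ := (integral_finsetSum _ fun s _ => hint s).symm
    _ ≤ ∫ _, (1 : ℝ) ∂μ := integral_mono_ae (integrable_finsetSum _ fun s _ => hint s)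
        (integrable_const _) hsum
    _ = 1 := by simp

end PartialForest

/-! ### Integer matrices acting on the torus -/

open AddCircle (haarAddCircle)

/-- The normalized Haar measure of the torus. -/
noncomputable def torusMeasure : Measure Torus :=
  (haarAddCircle : Measure UnitAddCircle).prod haarAddCircle

instance : IsProbabilityMeasure torusMeasure :=
  inferInstanceAs (IsProbabilityMeasure
    ((haarAddCircle : Measure UnitAddCircle).prod haarAddCircle))

instance : torusMeasure.IsOpenPosMeasure :=
  inferInstanceAs (((haarAddCircle : Measure UnitAddCircle).prod haarAddCircle).IsOpenPosMeasure)

/-- The shear of the torus along the second coordinate. -/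
def vShear (g : C(UnitAddCircle, UnitAddCircle)) : Torus ≃ₜ Torus where
  toFun x := (x.1, x.2 + g x.1)
  invFun x := (x.1, x.2 - g x.1)
  left_inv x := by simp
  right_inv x := by simp
  continuous_toFun := by fun_prop
  continuous_invFun := by fun_prop

/-- The shear of the torus along the first coordinate. -/
def hShear (g : C(UnitAddCircle, UnitAddCircle)) : Torus ≃ₜ Torus where
  toFun x := (x.1 + g x.2, x.2)
  invFun x := (x.1 - g x.2, x.2)
  left_inv x := by simp
  right_inv x := by simp
  continuous_toFun := by fun_prop
  continuous_invFun := by fun_prop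

theorem measurePreserving_vShear (g : C(UnitAddCircle, UnitAddCircle)) :
    MeasurePreserving (vShear g) torusMeasure torusMeasure := by
  refine MeasurePreserving.skew_product (MeasurePreserving.id _)
    (g := fun x y => y + g x) ?_ (Eventually.of_forall fun x => ?_)
  · exact (by fun_prop : Continuous fun p : Torus => p.2 + g p.1).measurable
  · exact (measurePreserving_add_right haarAddCircle (g x)).map_eq

theorem measurePreserving_hShear (g : C(UnitAddCircle, UnitAddCircle)) :
    MeasurePreserving (hShear g) torusMeasure torusMeasure := by
  have h : MeasurePreserving (Prod.swap : Torus → Torus) torusMeasure torusMeasure :=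
    Measure.measurePreserving_swap
  exact h.comp ((measurePreserving_vShear g).comp h)

theorem MeasureTheory.MeasurePreserving.homeomorph_symm {e : Torus ≃ₜ Torus}
    (h : MeasurePreserving e torusMeasure torusMeasure) :
    MeasurePreserving e.symm torusMeasure torusMeasure :=
  h.symm e.toMeasurableEquiv

/-- The multiplication by `2` on the circle. -/
def doubling : C(UnitAddCircle, UnitAddCircle) where
  toFun x := (2 : ℤ) • x
  continuous_toFun := by fun_prop

/-- The hyperbolic automorphism of the torus given by the product of two shears. -/
def hyperbolic : Torus ≃ₜ Torus := (hShear doubling).trans (vShear doubling)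

theorem hyperbolic_apply (x : Torus) :
    hyperbolic x = (x.1 + (2 : ℤ) • x.2, (2 : ℤ) • x.1 + (5 : ℤ) • x.2) := by
  change (x.1 + (2 : ℤ) • x.2, x.2 + (2 : ℤ) • (x.1 + (2 : ℤ) • x.2)) = _
  ext
  · rfl
  · dsimp only
    module

theorem measurePreserving_hyperbolic : MeasurePreserving hyperbolic torusMeasure torusMeasure :=
  (measurePreserving_vShear doubling).comp (measurePreserving_hShear doubling)

/-! ### Ergodicity of the hyperbolic automorphism -/

/-- The characters of the torus. -/
noncomputable def torusChar (n : Fin 2 → ℤ) (x : Torus) : ℂ := fourier (n 0) x.1 * fourier (n 1) x.2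

/-- The action of the hyperbolic automorphism on characters. -/
def dualMap (n : Fin 2 → ℤ) : Fin 2 → ℤ := ![n 0 + 2 * n 1, 2 * n 0 + 5 * n 1]

theorem torusChar_hyperbolic (n : Fin 2 → ℤ) (x : Torus) :
    torusChar n (hyperbolic x) = torusChar (dualMap n) x := by
  rw [hyperbolic_apply]
  simp only [torusChar, dualMap, fourier_apply, Matrix.cons_val_zero, Matrix.cons_val_one,
    ← Circle.coe_mul, ← AddCircle.toCircle_add]
  congr 2
  module

/-- The Fourier coefficients of the indicator function of a subset of the torus. -/
noncomputable def indicatorCoeff (B : Set Torus) (n : Fin 2 → ℤ) : ℂ :=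
  ∫ x, torusChar (-n) x * B.indicator 1 x ∂torusMeasure

theorem indicatorCoeff_dualMap {B : Set Torus} (h : hyperbolic ⁻¹' B = B) (n : Fin 2 → ℤ) :
    indicatorCoeff B (dualMap n) = indicatorCoeff B n := by
  have h1 := measurePreserving_hyperbolic.integral_comp
    hyperbolic.measurableEmbedding (fun x => torusChar (-n) x * B.indicator 1 x)
  rw [indicatorCoeff, indicatorCoeff, ← h1]
  refine integral_congr_ae (Eventually.of_forall fun x => ?_)
  have h2 : dualMap (-n) = - dualMap n := by
    ext i
    fin_cases i <;> simp [dualMap] <;> ring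
  have h3 : B.indicator (1 : Torus → ℂ) (hyperbolic x) = B.indicator 1 x := by
    conv_rhs => rw [← h]
    rfl
  change _ = torusChar (-n) (hyperbolic x) * B.indicator 1 (hyperbolic x)
  rw [torusChar_hyperbolic, h2, h3]

/-- The powers of the hyperbolic matrix. -/
theorem dualMap_iterate (m : ℕ) : ∃ p q : ℤ, 1 ≤ p ∧ 2 ≤ q ∧ p * (p + 2 * q) - q ^ 2 = 1 ∧
    ∀ n, dualMap^[m + 1] n = ![p * n 0 + q * n 1, q * n 0 + (p + 2 * q) * n 1] := by
  induction m with
  | zero => exact ⟨1, 2, le_rfl, le_rfl, by norm_num, fun n => by simp [dualMap]⟩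
  | succ m ih =>
    obtain ⟨p, q, hp, hq, h, ih⟩ := ih
    refine ⟨p + 2 * q, 2 * p + 5 * q, by linarith, by linarith, by linarith, fun n => ?_⟩
    rw [Function.iterate_succ_apply', ih]
    ext i
    fin_cases i <;> simp [dualMap] <;> ring

theorem eq_zero_of_dualMap_iterate_eq {m : ℕ} {n : Fin 2 → ℤ} (h : dualMap^[m + 1] n = n) :
    n = 0 := by
  obtain ⟨p, q, hp, hq, h1, h2⟩ := dualMap_iterate m
  rw [h2] at h
  have e0 : p * n 0 + q * n 1 = n 0 := congrFun h 0
  have e1 : q * n 0 + (p + 2 * q) * n 1 = n 1 := congrFun h 1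
  have hd : 2 - 2 * p - 2 * q ≠ 0 := by omega
  have f0 : (2 - 2 * p - 2 * q) * n 0 = 0 := by
    linear_combination (p + 2 * q - 1) * e0 - q * e1 - n 0 * h1
  have f1 : (2 - 2 * p - 2 * q) * n 1 = 0 := by
    linear_combination (p - 1) * e1 - q * e0 - n 1 * h1
  ext i
  fin_cases i
  · exact (mul_eq_zero.1 f0).resolve_left hd
  · exact (mul_eq_zero.1 f1).resolve_left hd

theorem dualMap_injective : Function.Injective dualMap := by
  intro n n' h
  have e0 : n 0 + 2 * n 1 = n' 0 + 2 * n' 1 := congrFun h 0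
  have e1 : 2 * n 0 + 5 * n 1 = 2 * n' 0 + 5 * n' 1 := congrFun h 1
  ext i
  fin_cases i
  · change n 0 = n' 0
    omega
  · change n 1 = n' 1
    omega

theorem dualMap_orbit_injective {n : Fin 2 → ℤ} (hn : n ≠ 0) :
    Function.Injective fun k : ℕ => dualMap^[k] n := by
  have key : ∀ k l : ℕ, k < l → dualMap^[k] n ≠ dualMap^[l] n := fun k l hkl h => by
    obtain ⟨m, rfl⟩ := Nat.exists_eq_add_of_lt hkl
    rw [add_assoc, Function.iterate_add_apply] at h
    exact hn (eq_zero_of_dualMap_iterate_eq (dualMap_injective.iterate k h).symm)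
  intro k l h
  by_contra hkl
  rcases Nat.lt_or_gt_of_ne hkl with h' | h'
  · exact key k l h' h
  · exact key l k h' h.symm

theorem measurePreserving_finTwoArrow_torus :
    MeasurePreserving (MeasurableEquiv.finTwoArrow (α := UnitAddCircle))
      (Measure.pi fun _ => haarAddCircle) torusMeasure :=
  measurePreserving_finTwoArrow haarAddCircle

/-- An invariant set is null or conull: the Fourier coefficients of its indicator function are
constant on the orbits of the dual automorphism, which are infinite except for the trivial one. -/
theorem hyperbolic_ergodic {B : Set Torus} (hB : MeasurableSet B) (h : hyperbolic ⁻¹' B = B) :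
    torusMeasure B = 0 ∨ torusMeasure Bᶜ = 0 := by
  set π : Measure (UnitAddTorus (Fin 2)) := Measure.pi fun _ => haarAddCircle with hπ
  set e := MeasurableEquiv.finTwoArrow (α := UnitAddCircle)
  have he : MeasurePreserving e π torusMeasure := measurePreserving_finTwoArrow_torus
  set B' : Set (UnitAddTorus (Fin 2)) := e ⁻¹' B
  have hB' : MeasurableSet B' := e.measurable hB
  have hmem : MemLp (B'.indicator (1 : UnitAddTorus (Fin 2) → ℂ)) 2 π :=
    memLp_indicator_const 2 hB' 1 (Or.inr (measure_ne_top _ _))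
  set F : Lp ℂ 2 π := hmem.toLp _
  have hF : F =ᵐ[π] B'.indicator 1 := hmem.coeFn_toLp
  have hcoeff : ∀ n, UnitAddTorus.mFourierCoeff F n = indicatorCoeff B n := fun n => by
    have h1 : UnitAddTorus.mFourierCoeff F n =
        ∫ t, UnitAddTorus.mFourier (-n) t • B'.indicator (1 : UnitAddTorus (Fin 2) → ℂ) t ∂π := by
      refine integral_congr_ae ?_
      filter_upwards [hF] with t ht
      rw [ht]
    rw [h1, indicatorCoeff, ← he.integral_comp e.measurableEmbedding]
    refine integral_congr_ae (Eventually.of_forall fun t => ?_)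
    simp only [UnitAddTorus.mFourier, ContinuousMap.coe_mk, Fin.prod_univ_two, torusChar,
      smul_eq_mul]
    rfl
  have hsum := (UnitAddTorus.hasSum_sq_mFourierCoeff F).summable
  have hzero : ∀ n, n ≠ 0 → UnitAddTorus.mFourierCoeff F n = 0 := fun n hn => by
    have h1 := hsum.comp_injective (dualMap_orbit_injective hn)
    have h2 : ∀ k : ℕ, UnitAddTorus.mFourierCoeff F (dualMap^[k] n) =
        UnitAddTorus.mFourierCoeff F n := fun k => by
      induction k with
      | zero => rfl
      | succ k ih =>
        rw [Function.iterate_succ_apply', hcoeff, indicatorCoeff_dualMap h, ← hcoeff, ih]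
    have h3 := h1.tendsto_atTop_zero
    simp only [Function.comp_def, h2] at h3
    have h4 := tendsto_nhds_unique tendsto_const_nhds h3
    simpa using h4
  have hFc : F =ᵐ[π] fun _ => UnitAddTorus.mFourierCoeff F 0 := by
    have h1 := UnitAddTorus.hasSum_mFourier_series_L2 F
    have h2 := h1.unique (hasSum_single 0 fun n hn => by rw [hzero n hn, zero_smul])
    have h3 := UnitAddTorus.coeFn_mFourierLp (d := Fin 2) 2 0
    have h4 := Lp.coeFn_smul (UnitAddTorus.mFourierCoeff F 0)
      (UnitAddTorus.mFourierLp (d := Fin 2) 2 0)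
    rw [← h2] at h4
    filter_upwards [h3, h4] with t h3 h4
    rw [h4, Pi.smul_apply, h3, UnitAddTorus.mFourier_zero]
    simp
  have hconst : ∀ᵐ t ∂π, B'.indicator (1 : UnitAddTorus (Fin 2) → ℂ) t =
      UnitAddTorus.mFourierCoeff F 0 := by
    filter_upwards [hF, hFc] with t h1 h2
    rw [← h1, h2]
  rw [← he.measure_preimage hB.nullMeasurableSet, ← he.measure_preimage hB.compl.nullMeasurableSet]
  by_cases hc : UnitAddTorus.mFourierCoeff F 0 = 1
  · right
    refine measure_mono_null (fun t ht => ?_) hconst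
    intro (h1 : B'.indicator 1 t = _)
    rw [hc, indicator_of_notMem (show t ∉ B' from ht)] at h1
    exact zero_ne_one h1
  · left
    refine measure_mono_null (fun t ht => ?_) hconst
    intro (h1 : B'.indicator 1 t = _)
    rw [indicator_of_mem (show t ∈ B' from ht)] at h1
    exact hc h1.symm

/-! ### A free group of automorphisms of the torus -/

open Matrix (SpecialLinearGroup)

section LinearAction

variable (V : Type*) [AddCommGroup V]

/-- The action of integer matrices on pairs of elements of an abelian group. -/
def matrixPerm : SpecialLinearGroup (Fin 2) ℤ →* Equiv.Perm (V × V) :=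
  MonoidHom.toHomPerm
    { toFun := fun M => (fun v : V × V =>
        (M 0 0 • v.1 + M 0 1 • v.2, M 1 0 • v.1 + M 1 1 • v.2) : Function.End (V × V))
      map_one' := by
        funext v
        change (_, _) = v
        ext <;> simp
      map_mul' := fun M N => by
        funext v
        change _ = (_, _)
        ext <;> simp [Matrix.mul_apply, Fin.sum_univ_two] <;> module }

theorem matrixPerm_apply (M : SpecialLinearGroup (Fin 2) ℤ) (v : V × V) :
    matrixPerm V M v = (M 0 0 • v.1 + M 0 1 • v.2, M 1 0 • v.1 + M 1 1 • v.2) := rfl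

end LinearAction

/-- The elementary matrices generating the Sanov subgroup. -/
def sanovGenerator : Fin 2 → SpecialLinearGroup (Fin 2) ℤ :=
  ![⟨!![1, 2; 0, 1], by simp [Matrix.det_fin_two]⟩, ⟨!![1, 0; 2, 1], by simp [Matrix.det_fin_two]⟩]

/-- The homomorphism from the free group onto the Sanov subgroup. -/
def sanov : FreeGroup (Fin 2) →* SpecialLinearGroup (Fin 2) ℤ := FreeGroup.lift sanovGenerator

/-- The action of integer matrices on nonzero integer vectors. -/
def nonzeroPerm : SpecialLinearGroup (Fin 2) ℤ →* Equiv.Perm {v : ℤ × ℤ // v ≠ 0} where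
  toFun M := (matrixPerm ℤ M).subtypePerm fun v => by
    refine not_congr ⟨fun h => ?_, ?_⟩
    · rw [← (matrixPerm ℤ M).symm_apply_apply v, h, ← Equiv.Perm.inv_def, ← map_inv,
        matrixPerm_apply]
      simp
    · rintro rfl
      simp [matrixPerm_apply]
  map_one' := by
    ext v <;> simp
  map_mul' M N := by
    ext v
    · exact congrArg Prod.fst (congrFun (congrArg DFunLike.coe (map_mul (matrixPerm ℤ) M N)) v.1)
    · exact congrArg Prod.snd (congrFun (congrArg DFunLike.coe (map_mul (matrixPerm ℤ) M N)) v.1)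

/-- The Sanov subgroup is free, by the ping-pong lemma: its generators translate by `2` the slopes
of integer vectors and their inverses, respectively. -/
theorem sanov_injective : Function.Injective sanov := by
  have key : Function.Injective (FreeGroup.lift fun i => nonzeroPerm (sanovGenerator i)) := by
    have h0 : ∀ v : {v : ℤ × ℤ // v ≠ 0}, (nonzeroPerm (sanovGenerator 0) v).1 =
        (v.1.1 + 2 * v.1.2, v.1.2) := fun v => by
      change matrixPerm ℤ _ v.1 = _
      rw [matrixPerm_apply]
      simp [sanovGenerator]
    have h1 : ∀ v : {v : ℤ × ℤ // v ≠ 0}, (nonzeroPerm (sanovGenerator 1) v).1 =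
        (v.1.1, 2 * v.1.1 + v.1.2) := fun v => by
      change matrixPerm ℤ _ v.1 = _
      rw [matrixPerm_apply]
      simp [sanovGenerator]
    have h0' : ∀ v : {v : ℤ × ℤ // v ≠ 0}, ((nonzeroPerm (sanovGenerator 0))⁻¹ v).1 =
        (v.1.1 - 2 * v.1.2, v.1.2) := fun v => by
      obtain ⟨u, rfl⟩ := (nonzeroPerm (sanovGenerator 0)).surjective v
      rw [Equiv.Perm.inv_def, Equiv.symm_apply_apply, h0]
      simp
    have h1' : ∀ v : {v : ℤ × ℤ // v ≠ 0}, ((nonzeroPerm (sanovGenerator 1))⁻¹ v).1 =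
        (v.1.1, v.1.2 - 2 * v.1.1) := fun v => by
      obtain ⟨u, rfl⟩ := (nonzeroPerm (sanovGenerator 1)).surjective v
      rw [Equiv.Perm.inv_def, Equiv.symm_apply_apply, h1]
      simp
    have hne : ∀ v : {v : ℤ × ℤ // v ≠ 0}, v.1.1 = 0 → v.1.2 ≠ 0 := fun v h h' =>
      v.2 (Prod.ext h h')
    let S : Fin 2 → Set {v : ℤ × ℤ // v ≠ 0} :=
      ![{v | v.1.2 ^ 2 ≤ v.1.1 * v.1.2}, {v | v.1.1 ^ 2 < v.1.1 * v.1.2 ∨ v.1.1 = 0}]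
    let S' : Fin 2 → Set {v : ℤ × ℤ // v ≠ 0} :=
      ![{v | v.1.1 * v.1.2 < - v.1.2 ^ 2}, {v | v.1.1 * v.1.2 ≤ - v.1.1 ^ 2 ∧ v.1.1 ≠ 0}]
    have hS0 : ∀ v, v ∈ S 0 ↔ v.1.2 ^ 2 ≤ v.1.1 * v.1.2 := fun _ => Iff.rfl
    have hS1 : ∀ v, v ∈ S 1 ↔ v.1.1 ^ 2 < v.1.1 * v.1.2 ∨ v.1.1 = 0 := fun _ => Iff.rfl
    have hS0' : ∀ v, v ∈ S' 0 ↔ v.1.1 * v.1.2 < - v.1.2 ^ 2 := fun _ => Iff.rfl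
    have hS1' : ∀ v, v ∈ S' 1 ↔ v.1.1 * v.1.2 ≤ - v.1.1 ^ 2 ∧ v.1.1 ≠ 0 := fun _ => Iff.rfl
    have d01 : Disjoint (S 0) (S 1) := by
      rw [Set.disjoint_left]
      rintro v h (h' | h')
      · rw [hS0] at h
        nlinarith [sq_nonneg (v.1.1 - v.1.2)]
      · rw [hS0, h', zero_mul] at h
        exact hne v h' (pow_eq_zero_iff two_ne_zero |>.1 (le_antisymm h (sq_nonneg _)))
    have d01' : Disjoint (S' 0) (S' 1) := by
      rw [Set.disjoint_left]
      intro v h h'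
      rw [hS0'] at h
      rw [hS1'] at h'
      nlinarith [sq_nonneg (v.1.1 + v.1.2), h'.1]
    refine FreeGroup.injective_lift_of_ping_pong (fun i => nonzeroPerm (sanovGenerator i)) S S'
      ?_ ?_ ?_ ?_ ?_ ?_
    · intro i
      fin_cases i
      · exact ⟨⟨(1, 0), by simp⟩, by simp [S]⟩
      · exact ⟨⟨(0, 1), by simp⟩, by simp [S]⟩
    · intro i j hij
      fin_cases i <;> fin_cases j <;> first
        | exact absurd rfl hij
        | exact d01
        | exact d01.symm
    · intro i j hij
      fin_cases i <;> fin_cases j <;> first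
        | exact absurd rfl hij
        | exact d01'
        | exact d01'.symm
    · intro i j
      rw [Set.disjoint_left]
      intro v h h'
      fin_cases i <;> fin_cases j
      · have h1 := (hS0 v).1 h
        have h2 := (hS0' v).1 h'
        nlinarith [sq_nonneg v.1.2]
      · have h1 := (hS0 v).1 h
        have h2 := (hS1' v).1 h'
        nlinarith [sq_nonneg v.1.2, pow_pos (abs_pos.2 h2.2) 2, sq_abs v.1.1, h2.1]
      · have h2 := (hS0' v).1 h'
        rcases (hS1 v).1 h with h1 | h1
        · nlinarith [sq_nonneg v.1.2, sq_nonneg v.1.1]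
        · rw [h1] at h2
          nlinarith [sq_nonneg v.1.2]
      · have h2 := (hS1' v).1 h'
        rcases (hS1 v).1 h with h1 | h1
        · nlinarith [sq_nonneg v.1.1, h2.1]
        · exact h2.2 h1
    · intro i
      rintro _ ⟨v, hv, rfl⟩
      fin_cases i
      · have h1 := not_lt.1 (fun h => hv ((hS0' v).2 h))
        refine (hS0 _).2 ?_
        change ((nonzeroPerm (sanovGenerator 0) v).1).2 ^ 2 ≤
          ((nonzeroPerm (sanovGenerator 0) v).1).1 * ((nonzeroPerm (sanovGenerator 0) v).1).2
        rw [h0]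
        dsimp only
        linarith
      · refine (hS1 _).2 ?_
        change ((nonzeroPerm (sanovGenerator 1) v).1).1 ^ 2 <
          ((nonzeroPerm (sanovGenerator 1) v).1).1 * ((nonzeroPerm (sanovGenerator 1) v).1).2 ∨
          ((nonzeroPerm (sanovGenerator 1) v).1).1 = 0
        rw [h1]
        dsimp only
        by_cases h2 : v.1.1 = 0
        · exact Or.inr h2
        · have h3 := not_le.1 (fun h => hv ((hS1' v).2 ⟨h, h2⟩))
          exact Or.inl (by linarith)
    · intro i
      rintro _ ⟨v, hv, rfl⟩
      fin_cases i
      · have h1 := not_le.1 (fun h => hv ((hS0 v).2 h))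
        refine (hS0' _).2 ?_
        change (((nonzeroPerm (sanovGenerator 0))⁻¹ v).1).1 *
          (((nonzeroPerm (sanovGenerator 0))⁻¹ v).1).2 <
          - (((nonzeroPerm (sanovGenerator 0))⁻¹ v).1).2 ^ 2
        rw [h0']
        dsimp only
        linarith
      · have h1 := not_or.1 (fun h => hv ((hS1 v).2 h))
        refine (hS1' _).2 ?_
        change (((nonzeroPerm (sanovGenerator 1))⁻¹ v).1).1 *
          (((nonzeroPerm (sanovGenerator 1))⁻¹ v).1).2 ≤
          - (((nonzeroPerm (sanovGenerator 1))⁻¹ v).1).1 ^ 2 ∧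
          (((nonzeroPerm (sanovGenerator 1))⁻¹ v).1).1 ≠ 0
        rw [h1']
        dsimp only
        exact ⟨by linarith [not_lt.1 h1.1], h1.2⟩
  intro g g' h
  have he : (FreeGroup.lift fun i => nonzeroPerm (sanovGenerator i)) = nonzeroPerm.comp sanov := by
    ext i : 1
    simp [sanov]
  refine key ?_
  rw [he, MonoidHom.comp_apply, MonoidHom.comp_apply, h]

theorem haarAddCircle_closedBall (x : UnitAddCircle) (ε : ℝ) :
    haarAddCircle (Metric.closedBall x ε) = ENNReal.ofReal (min 1 (2 * ε)) := by
  have h := AddCircle.volume_eq_smul_haarAddCircle (T := 1)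
  rw [ENNReal.ofReal_one, one_smul] at h
  rw [← h, AddCircle.volume_closedBall]

theorem measure_zsmul_eq_eq_zero {p : ℤ} (hp : p ≠ 0) (w : UnitAddCircle) :
    haarAddCircle {x : UnitAddCircle | p • x = w} = 0 := by
  have h := Measure.measurePreserving_zsmul (haarAddCircle : Measure UnitAddCircle) hp
  have h1 := h.measure_preimage
    (Metric.isClosed_closedBall (x := w) (ε := 0)).measurableSet.nullMeasurableSet
  rw [haarAddCircle_closedBall, Metric.closedBall_zero] at h1
  calc _ = _ := h1
    _ = 0 := by simp

/-- The kernel of a nontrivial character is a null set. -/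
theorem measure_char_ker_eq_zero {p q : ℤ} (h : p ≠ 0 ∨ q ≠ 0) :
    torusMeasure {x : Torus | p • x.1 + q • x.2 = 0} = 0 := by
  have key : ∀ {p q : ℤ}, q ≠ 0 → torusMeasure {x : Torus | p • x.1 + q • x.2 = 0} = 0 :=
    fun {p q} hq => by
      have hm : MeasurableSet {x : Torus | p • x.1 + q • x.2 = 0} :=
        (isClosed_eq (by fun_prop) (by fun_prop)).measurableSet
      refine (Measure.measure_prod_null hm).2 (Eventually.of_forall fun x => ?_)
      have := measure_zsmul_eq_eq_zero hq (-(p • x))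
      change haarAddCircle {y : UnitAddCircle | p • x + q • y = 0} = 0
      rw [← this]
      congr 1
      ext y
      change p • x + q • y = 0 ↔ q • y = -(p • x)
      rw [add_comm, add_eq_zero_iff_eq_neg]
  rcases h with h | h
  · have hs : MeasurePreserving (Prod.swap : Torus → Torus) torusMeasure torusMeasure :=
      Measure.measurePreserving_swap
    have hm : MeasurableSet {x : Torus | q • x.1 + p • x.2 = 0} :=
      (isClosed_eq (by fun_prop) (by fun_prop)).measurableSet
    rw [← key (p := q) h, ← hs.measure_preimage hm.nullMeasurableSet]
    congr 1
    ext x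
    change p • x.1 + q • x.2 = 0 ↔ q • x.2 + p • x.1 = 0
    rw [add_comm]
  · exact key h

/-- The action of invertible integer matrices on the torus is essentially free. -/
theorem ae_matrixPerm_ne (M : SpecialLinearGroup (Fin 2) ℤ) (hM : M ≠ 1) :
    ∀ᵐ x ∂torusMeasure, matrixPerm UnitAddCircle M x ≠ x := by
  have h0 : ∀ x, matrixPerm UnitAddCircle M x = x →
      (M 0 0 - 1) • x.1 + M 0 1 • x.2 = 0 ∧ M 1 0 • x.1 + (M 1 1 - 1) • x.2 = 0 := fun x hx => by
    rw [matrixPerm_apply] at hx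
    have h1 := congrArg Prod.fst hx
    have h2 := congrArg Prod.snd hx
    dsimp only at h1 h2
    constructor
    · rw [sub_smul, one_smul, sub_add_eq_add_sub, h1, sub_self]
    · rw [sub_smul, one_smul, ← add_sub_assoc, h2, sub_self]
  have h1 : (M 0 0 - 1 ≠ 0 ∨ M 0 1 ≠ 0) ∨ (M 1 0 ≠ 0 ∨ M 1 1 - 1 ≠ 0) := by
    by_contra! h
    refine hM (Subtype.ext ?_)
    ext i j
    fin_cases i <;> fin_cases j
    · exact sub_eq_zero.1 h.1.1
    · exact h.1.2
    · exact h.2.1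
    · exact sub_eq_zero.1 h.2.2
  rcases h1 with h1 | h1
  · refine measure_mono_null (fun x hx => ?_) (measure_char_ker_eq_zero h1)
    exact (h0 x (not_not.1 hx)).1
  · refine measure_mono_null (fun x hx => ?_) (measure_char_ker_eq_zero h1)
    exact (h0 x (not_not.1 hx)).2

/-- The action of the free group on the torus through the Sanov subgroup. -/
def sanovAction : FreeGroup (Fin 2) →* Equiv.Perm Torus := (matrixPerm UnitAddCircle).comp sanov

theorem sanovAction_of_zero (x : Torus) :
    sanovAction (FreeGroup.of 0) x = hShear doubling x := by
  simp only [sanovAction, sanov, MonoidHom.comp_apply, FreeGroup.lift_apply_of, matrixPerm_apply]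
  simp [sanovGenerator, hShear, doubling]

theorem sanovAction_of_one (x : Torus) :
    sanovAction (FreeGroup.of 1) x = vShear doubling x := by
  simp only [sanovAction, sanov, MonoidHom.comp_apply, FreeGroup.lift_apply_of, matrixPerm_apply]
  simp [sanovGenerator, vShear, doubling, add_comm]

theorem sanovAction_free :
    ∀ᵐ x ∂torusMeasure, ∀ g : FreeGroup (Fin 2), g ≠ 1 → sanovAction g x ≠ x := by
  have : Countable (FreeGroup (Fin 2)) := FreeGroup.toWord_injective.countable
  refine ae_all_iff.2 fun g => ?_
  by_cases hg : g = 1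
  · exact Eventually.of_forall fun x h => absurd hg h
  · filter_upwards [ae_matrixPerm_ne (sanov g)
      (fun h => hg (sanov_injective (h.trans (map_one sanov).symm)))] with x hx _
    exact hx

theorem measurePreserving_sanovAction (g : FreeGroup (Fin 2)) :
    MeasurePreserving (sanovAction g) torusMeasure torusMeasure := by
  have hof : ∀ i, ∃ e : Torus ≃ₜ Torus, MeasurePreserving e torusMeasure torusMeasure ∧
      sanovAction (FreeGroup.of i) = e.toEquiv := fun i => by
    fin_cases i
    · exact ⟨_, measurePreserving_hShear doubling, Equiv.ext sanovAction_of_zero⟩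
    · exact ⟨_, measurePreserving_vShear doubling, Equiv.ext sanovAction_of_one⟩
  induction g using FreeGroup.induction_on with
  | C1 =>
    rw [map_one]
    exact MeasurePreserving.id _
  | of i =>
    obtain ⟨e, he, h⟩ := hof i
    rw [h]
    exact he
  | inv_of i _ =>
    obtain ⟨e, he, h⟩ := hof i
    rw [map_inv, h]
    exact he.homeomorph_symm
  | mul g g' h h' =>
    rw [map_mul]
    exact h.comp h'

/-- Almost all orbits of the hyperbolic automorphism are infinite. -/
theorem ae_hyperbolic_injective :
    ∀ᵐ x ∂torusMeasure, Function.Injective fun k : ℕ => hyperbolic^[k] x := by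
  have hc : ∀ k x, hyperbolic^[k] x = sanovAction ((FreeGroup.of 1 * FreeGroup.of 0) ^ k) x := by
    intro k x
    induction k with
    | zero => simp
    | succ k ih =>
      rw [Function.iterate_succ_apply', ih, pow_succ', map_mul, Equiv.Perm.mul_apply, map_mul,
        Equiv.Perm.mul_apply, sanovAction_of_zero, sanovAction_of_one]
      rfl
  have hne : (FreeGroup.of (1 : Fin 2) * FreeGroup.of 0) ≠ 1 := by
    intro h
    have := congrArg FreeGroup.toWord h
    revert this
    decide
  filter_upwards [sanovAction_free] with x hx
  have key : ∀ k l : ℕ, k < l → hyperbolic^[k] x ≠ hyperbolic^[l] x := fun k l hkl h => by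
    obtain ⟨m, rfl⟩ := Nat.exists_eq_add_of_lt hkl
    rw [add_assoc, Function.iterate_add_apply] at h
    have h1 := (hyperbolic.injective.iterate k h).symm
    rw [hc] at h1
    exact hx _ (fun h => hne (pow_eq_one_iff_left m.succ_ne_zero |>.1 h)) h1
  intro k l h
  by_contra hkl
  rcases Nat.lt_or_gt_of_ne hkl with h' | h'
  · exact key k l h' h
  · exact key l k h' h.symm

/-! ### The cut-off shear -/

/-- A bump function on the line, equal to `1` near `0` and supported in `[-1/8, 1/8]`. -/
noncomputable def lineBump : ContDiffBump (0 : ℝ) := ⟨1 / 16, 1 / 8, by norm_num, by norm_num⟩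

/-- A smooth approximation of `t ↦ 2 * t`, equal to it away from the integers and locally constant
near the integers. -/
noncomputable def cutoffLift (t : ℝ) : ℝ :=
  2 * t - 2 * (lineBump (t - round t) * (t - round t))

theorem cutoffLift_add_one (t : ℝ) : cutoffLift (t + 1) = cutoffLift t + 2 := by
  have h : t + 1 - (round (t + 1) : ℝ) = t - round t := by
    rw [round_add_one]
    push_cast
    ring
  rw [cutoffLift, cutoffLift, h]
  ring

theorem cutoffLift_of_far {t : ℝ} (h : 1 / 8 ≤ |t - round t|) : cutoffLift t = 2 * t := by
  have : lineBump (t - round t) = 0 := lineBump.zero_of_le_dist (by rwa [dist_zero_right])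
  rw [cutoffLift, this]
  ring

theorem cutoffLift_of_near {t : ℝ} (h : |t - round t| ≤ 1 / 16) : cutoffLift t = 2 * round t := by
  have : lineBump (t - round t) = 1 :=
    lineBump.one_of_mem_closedBall (by rwa [mem_closedBall_zero_iff])
  rw [cutoffLift, this]
  ring

/-- Near a point, the distance to the nearest integer is at least `1 / 8` or the nearest integer is
constant. -/
theorem contDiff_cutoffLift : ContDiff ℝ ∞ cutoffLift := by
  refine contDiff_iff_contDiffAt.2 fun t => ?_
  by_cases h : |t - round t| < 1 / 4
  · have h1 : ∀ᶠ s : ℝ in 𝓝 t, round s = round t := by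
      have h2 : ∀ᶠ s : ℝ in 𝓝 t, |s - round t| < 1 / 4 :=
        (isOpen_lt (f := fun s : ℝ => |s - round t|) (by fun_prop) (by fun_prop)).mem_nhds h
      filter_upwards [h2] with s hs
      rw [round_eq, Int.floor_eq_iff]
      rw [abs_lt] at hs
      constructor <;> linarith
    have h3 : ContDiffAt ℝ ∞ (fun s : ℝ =>
        2 * s - 2 * (lineBump (s - round t) * (s - round t))) t := by
      have h4 : ContDiff ℝ ∞ fun s : ℝ => lineBump (s - round t) :=
        lineBump.contDiff.comp (by fun_prop)
      exact ContDiff.contDiffAt (by fun_prop)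
    refine h3.congr_of_eventuallyEq ?_
    filter_upwards [h1] with s hs
    rw [cutoffLift, hs]
  · have h1 : ∀ᶠ s : ℝ in 𝓝 t, 1 / 8 ≤ |s - round s| := by
      have h2 : ∀ᶠ s : ℝ in 𝓝 t, |s - t| < 1 / 8 :=
        (isOpen_lt (f := fun s : ℝ => |s - t|) (by fun_prop) (by fun_prop)).mem_nhds
          (by simp)
      filter_upwards [h2] with s hs
      have h3 := round_le t (round s)
      have h4 := abs_sub_le t s (round s)
      rw [abs_sub_comm t s] at h4
      linarith [not_lt.1 h]
    have h3 : ContDiffAt ℝ ∞ (fun s : ℝ => 2 * s) t := ContDiff.contDiffAt (by fun_prop)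
    refine h3.congr_of_eventuallyEq ?_
    filter_upwards [h1] with s hs
    exact cutoffLift_of_far hs

/-- The self-map of the circle of degree `2` covered by `cutoffLift`. -/
noncomputable def cutoffDoubling : C(UnitAddCircle, UnitAddCircle) where
  toFun := Function.Periodic.lift (f := fun t : ℝ => (cutoffLift t : UnitAddCircle)) (c := 1)
    (fun t => by
      change ((cutoffLift (t + 1) : ℝ) : UnitAddCircle) = (cutoffLift t : ℝ)
      rw [cutoffLift_add_one, AddCircle.coe_add]
      have : ((2 : ℝ) : UnitAddCircle) = 0 := (AddCircle.coe_eq_zero_iff 1).2 ⟨2, by simp⟩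
      rw [this, add_zero])
  continuous_toFun := by
    refine continuous_coinduced_dom.2 ?_
    exact (AddCircle.continuous_mk' 1).comp contDiff_cutoffLift.continuous

theorem cutoffDoubling_coe (t : ℝ) : cutoffDoubling (t : UnitAddCircle) = (cutoffLift t : ℝ) := rfl

theorem cutoffDoubling_of_far {x : UnitAddCircle} (h : 1 / 8 ≤ ‖x‖) :
    cutoffDoubling x = doubling x := by
  induction x using QuotientAddGroup.induction_on with
  | H t =>
    rw [UnitAddCircle.norm_eq] at h
    rw [cutoffDoubling_coe, cutoffLift_of_far h]
    change _ = (2 : ℤ) • (t : UnitAddCircle)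
    rw [← AddCircle.coe_zsmul]
    simp

theorem cutoffDoubling_of_near {x : UnitAddCircle} (h : ‖x‖ < 1 / 16) :
    cutoffDoubling x = 0 := by
  induction x using QuotientAddGroup.induction_on with
  | H t =>
    rw [UnitAddCircle.norm_eq] at h
    rw [cutoffDoubling_coe, cutoffLift_of_near h.le]
    exact (AddCircle.coe_eq_zero_iff 1).2 ⟨2 * round t, by simp⟩

/-! ### The monodromy -/

/-- The monodromy of the suspension: the identity, a shear cut off near the fixed point of the
hyperbolic automorphism, and the hyperbolic automorphism. -/
noncomputable def monodromy : Fin 3 → Torus ≃ₜ Torus :=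
  ![Homeomorph.refl _, hShear cutoffDoubling, hyperbolic]

theorem contDiff_mk {a b : Plane → ℝ} (ha : ContDiff ℝ ∞ a) (hb : ContDiff ℝ ∞ b) :
    ContDiff ℝ ∞ fun v : Plane => (!₂[a v, b v] : Plane) := by
  rw [contDiff_euclidean]
  intro i
  fin_cases i
  · exact ha
  · exact hb

theorem contDiff_coord (i : Fin 2) : ContDiff ℝ ∞ fun v : Plane => v i := by
  fun_prop

theorem hyperbolic_symm_apply (x : Torus) :
    hyperbolic.symm x = ((5 : ℤ) • x.1 - (2 : ℤ) • x.2, x.2 - (2 : ℤ) • x.1) := by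
  rw [Homeomorph.symm_apply_eq, hyperbolic_apply]
  ext <;> dsimp only <;> module

instance : Pants.Suspension.IsSmoothMonodromy monodromy where
  lifts ε j := by
    have h0 := contDiff_coord 0
    have h1 := contDiff_coord 1
    have hφ := contDiff_cutoffLift.comp h1
    fin_cases j <;> cases ε
    · exact HasSmoothLifts.id
    · exact HasSmoothLifts.id
    · refine .of_lift (fun v => !₂[v 0 - cutoffLift (v 1), v 1])
        (contDiff_mk (h0.sub hφ) h1) fun u => ?_
      change _ = (((u 0 : ℝ) : UnitAddCircle) - cutoffDoubling (u 1 : ℝ), _)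
      rw [cutoffDoubling_coe, ← AddCircle.coe_sub]
      rfl
    · refine .of_lift (fun v => !₂[v 0 + cutoffLift (v 1), v 1])
        (contDiff_mk (h0.add hφ) h1) fun u => ?_
      change _ = (((u 0 : ℝ) : UnitAddCircle) + cutoffDoubling (u 1 : ℝ), _)
      rw [cutoffDoubling_coe, ← AddCircle.coe_add]
      rfl
    · refine .of_lift (fun v => !₂[(5 : ℤ) • v 0 - (2 : ℤ) • v 1, v 1 - (2 : ℤ) • v 0])
        (contDiff_mk (by fun_prop) (by fun_prop)) fun u => ?_
      change _ = hyperbolic.symm (torusMk u)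
      rw [hyperbolic_symm_apply]
      simp only [torusMk, ← AddCircle.coe_zsmul, ← AddCircle.coe_sub]
      rfl
    · refine .of_lift (fun v => !₂[v 0 + (2 : ℤ) • v 1, (2 : ℤ) • v 0 + (5 : ℤ) • v 1])
        (contDiff_mk (by fun_prop) (by fun_prop)) fun u => ?_
      change _ = hyperbolic (torusMk u)
      rw [hyperbolic_apply]
      simp only [torusMk, ← AddCircle.coe_zsmul, ← AddCircle.coe_add]
      rfl

theorem measurePreserving_holonomy (ε : Bool) (j : Fin 3) :
    MeasurePreserving (Pants.holonomy monodromy ε j) torusMeasure torusMeasure := by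
  have h : ∀ j, MeasurePreserving (monodromy j) torusMeasure torusMeasure := fun j => by
    fin_cases j
    · exact MeasurePreserving.id _
    · exact measurePreserving_hShear _
    · exact measurePreserving_hyperbolic
  cases ε
  · exact (h j).homeomorph_symm
  · exact h j

open Pants

/-- The region of the torus where the cut-off shear agrees with the linear one. -/
def shearRegion : Set Torus := {x | 1 / 8 < ‖x.2‖}

theorem measurableSet_shearRegion : MeasurableSet shearRegion :=
  (isOpen_lt (by fun_prop) (by fun_prop)).measurableSet

theorem measureReal_shearRegion : torusMeasure.real shearRegion = 3 / 4 := by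
  have h : shearRegionᶜ = univ ×ˢ Metric.closedBall (0 : UnitAddCircle) (1 / 8) := by
    ext x
    simp [shearRegion]
  have h1 : torusMeasure.real shearRegionᶜ = 1 / 4 := by
    rw [h, Measure.real, torusMeasure, Measure.prod_prod, haarAddCircle_closedBall]
    norm_num
  have h2 := measureReal_add_measureReal_compl (μ := torusMeasure) measurableSet_shearRegion
  rw [h1, probReal_univ] at h2
  linarith

theorem orbitSetoid_hShear {x : Torus} (hx : x ∈ shearRegion) :
    orbitSetoid monodromy x (hShear doubling x) := by
  have h := orbitSetoid_apply monodromy 1 x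
  have h1 : monodromy 1 x = hShear doubling x := by
    change (x.1 + cutoffDoubling x.2, x.2) = (x.1 + doubling x.2, x.2)
    rw [cutoffDoubling_of_far (le_of_lt hx)]
  rwa [h1] at h

theorem orbitSetoid_vShear {x : Torus} (hx : x ∈ shearRegion) :
    orbitSetoid monodromy x (vShear doubling x) := by
  set y := (hShear doubling).symm x
  have hy : y ∈ shearRegion := hx
  have h1 := orbitSetoid_hShear hy
  have h2 := orbitSetoid_apply monodromy 2 y
  have h3 : hShear doubling y = x := (hShear doubling).apply_symm_apply x
  have h4 : monodromy 2 y = vShear doubling x := by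
    change vShear doubling (hShear doubling y) = _
    rw [h3]
  rw [h3] at h1
  rw [h4] at h2
  exact (orbitSetoid monodromy).trans ((orbitSetoid monodromy).symm h1) h2

/-- The orbits of the monodromy group are enumerated by continuous maps. -/
theorem exists_orbit_enumeration (f : Fin 3 → Torus ≃ₜ Torus) : ∃ θ : ℕ → Torus → Torus,
    (∀ n, Continuous (θ n)) ∧ ∀ x y, orbitSetoid f x y → ∃ n, θ n x = y := by
  have : Countable (FreeGroup (Fin 3)) := FreeGroup.toWord_injective.countable
  obtain ⟨w, hw⟩ := exists_surjective_nat (FreeGroup (Fin 3))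
  refine ⟨fun n => FreeGroup.lift f (w n), fun n => (FreeGroup.lift f (w n)).continuous, ?_⟩
  rintro x y ⟨g, hg, rfl⟩
  rw [← FreeGroup.range_lift_eq_closure] at hg
  obtain ⟨u, rfl⟩ := hg
  obtain ⟨n, rfl⟩ := hw u
  exact ⟨n, rfl⟩

/-- The orbit equivalence relation of the monodromy group is not amenable. -/
theorem not_isMeanSystem (m : Torus → Set Torus → ℝ) :
    ¬ (orbitSetoid monodromy).IsMeanSystem torusMeasure m := by
  intro hm
  obtain ⟨θ, hθ, hr⟩ := exists_orbit_enumeration monodromy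
  have h := PartialForest.sum_measureReal_le_one sanovAction (fun _ => shearRegion) θ torusMeasure
    measurePreserving_sanovAction (fun _ => measurableSet_shearRegion) sanovAction_free
    (fun n => (hθ n).measurable) hr (fun a x hx => by
      fin_cases a
      · exact (sanovAction_of_zero x).symm ▸ orbitSetoid_hShear hx
      · exact (sanovAction_of_one x).symm ▸ orbitSetoid_vShear hx) hm
  simp only [Fin.sum_univ_two, measureReal_shearRegion] at h
  norm_num at h

/-- Saturated sets are null or conull. -/
theorem ergodic_orbitSetoid {B : Set Torus} (hB : MeasurableSet B)
    (h : ∀ x y, orbitSetoid monodromy x y → x ∈ B → y ∈ B) :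
    torusMeasure B = 0 ∨ torusMeasure Bᶜ = 0 := by
  refine hyperbolic_ergodic hB ?_
  ext x
  have h1 : orbitSetoid monodromy x (hyperbolic x) := orbitSetoid_apply monodromy 2 x
  exact ⟨h _ _ ((orbitSetoid monodromy).symm h1), h _ _ h1⟩

/-- The points whose first `N` iterates under the hyperbolic automorphism are different and lie in
the strip where the cut-off shear is trivial. -/
def quietSet (N : ℕ) : Set Torus :=
  {x | (∀ i < N, ‖(hyperbolic^[i] x).2‖ < 1 / 16) ∧
    Function.Injective fun k : ℕ => hyperbolic^[k] x}

/-- Almost every orbit of the monodromy group visits `quietSet N`, by ergodicity, since the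
hyperbolic automorphism has a fixed point in the strip. -/
theorem ae_exists_mem_quietSet (N : ℕ) :
    ∀ᵐ x ∂torusMeasure, ∃ y, orbitSetoid monodromy x y ∧ y ∈ quietSet N := by
  set U : Set Torus := {x | ∀ i < N, ‖(hyperbolic^[i] x).2‖ < 1 / 16} with hU
  have hUo : IsOpen U := by
    have : U = ⋂ i ∈ Finset.range N, {x | ‖(hyperbolic^[i] x).2‖ < 1 / 16} := by
      ext x
      simp [hU]
    rw [this]
    refine isOpen_biInter_finset fun i _ => ?_
    exact isOpen_lt (continuous_snd.comp (hyperbolic.continuous.iterate i)).norm continuous_const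
  have hU0 : (0 : Torus) ∈ U := fun i _ => by
    have h0 : hyperbolic (0 : Torus) = 0 := by
      rw [hyperbolic_apply]
      simp
    rw [Function.iterate_fixed h0]
    simp
  have hUp : torusMeasure U ≠ 0 := (hUo.measure_pos _ ⟨0, hU0⟩).ne'
  obtain ⟨Z, hZ, hZm, hZ0⟩ := exists_measurable_superset_of_null ae_hyperbolic_injective
  have hQ : U \ Z ⊆ quietSet N := fun x hx =>
    ⟨hx.1, by_contra fun h => hx.2 (hZ h)⟩
  have hQm : MeasurableSet (U \ Z) := hUo.measurableSet.diff hZm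
  have hQp : torusMeasure (U \ Z) ≠ 0 := by rwa [measure_sdiff_null hZ0]
  set S : Set Torus := {x | ∃ g ∈ Subgroup.closure (range monodromy), g x ∈ U \ Z} with hS
  have hSm : MeasurableSet S := by
    have hc : (Subgroup.closure (range monodromy) : Set (Torus ≃ₜ Torus)).Countable := by
      rw [← FreeGroup.range_lift_eq_closure]
      have : Countable (FreeGroup (Fin 3)) := FreeGroup.toWord_injective.countable
      exact countable_range _
    have : S = ⋃ g ∈ (Subgroup.closure (range monodromy) : Set (Torus ≃ₜ Torus)),
        g ⁻¹' (U \ Z) := by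
      ext x
      simp only [hS, mem_ofPred_eq, mem_iUnion, mem_preimage, SetLike.mem_coe, exists_prop]
    rw [this]
    exact MeasurableSet.biUnion hc fun g _ => g.continuous.measurable hQm
  have hSs : ∀ x y, orbitSetoid monodromy x y → x ∈ S → y ∈ S := by
    rintro x _ ⟨g, hg, rfl⟩ ⟨g', hg', h⟩
    refine ⟨g' * g⁻¹, mul_mem hg' (inv_mem hg), ?_⟩
    change g' (g.symm (g x)) ∈ U \ Z
    rwa [g.symm_apply_apply]
  rcases ergodic_orbitSetoid hSm hSs with h | h
  · exact absurd (measure_mono_null (fun x hx => show x ∈ S from ⟨1, one_mem _, hx⟩) h) hQp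
  · filter_upwards [compl_mem_ae_iff.2 h] with x hx
    obtain ⟨g, hg, hx⟩ := not_not.1 hx
    exact ⟨g x, ⟨g, hg, rfl⟩, hQ hx⟩

/-- The generators move a point of an orbit segment of the hyperbolic automorphism within the strip
to another one, except at the ends of the segment. -/
theorem holonomy_mem_segment {N : ℕ} {x : Torus} (hx : x ∈ quietSet N) {i : ℕ} (h0 : i ≠ 0)
    (hi : i + 1 < N) {H : Torus ≃ₜ Torus}
    (hH : H = Homeomorph.refl _ ∨ ∃ ε j, H = holonomy monodromy ε j) :
    ∃ k < N, H (hyperbolic^[i] x) = hyperbolic^[k] x := by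
  have hφ : cutoffDoubling (hyperbolic^[i] x).2 = 0 :=
    cutoffDoubling_of_near (hx.1 i (by omega))
  rcases hH with rfl | ⟨ε, j, rfl⟩
  · exact ⟨i, by omega, rfl⟩
  · fin_cases j
    · refine ⟨i, by omega, ?_⟩
      cases ε <;> rfl
    · refine ⟨i, by omega, ?_⟩
      cases ε
      · change ((hyperbolic^[i] x).1 - cutoffDoubling (hyperbolic^[i] x).2, _) = _
        rw [hφ, sub_zero]
      · change ((hyperbolic^[i] x).1 + cutoffDoubling (hyperbolic^[i] x).2, _) = _
        rw [hφ, add_zero]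
    · cases ε
      · obtain ⟨i, rfl⟩ := Nat.exists_eq_succ_of_ne_zero h0
        refine ⟨i, by omega, ?_⟩
        rw [Function.iterate_succ_apply']
        exact hyperbolic.symm_apply_apply _
      · exact ⟨i + 1, hi, (Function.iterate_succ_apply' _ _ _).symm⟩

/-! ### Measures on disjoint unions -/

section SigmaPullback

variable {n : ℕ} {Y : Fin n → Type*} [∀ i, MeasurableSpace (Y i)] {X : Type*} [MeasurableSpace X]

theorem measurableSet_sigma {S : Set (Σ i, Y i)} :
    MeasurableSet S ↔ ∀ i, MeasurableSet (Sigma.mk i ⁻¹' S) :=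
  MeasurableSpace.measurableSet_iInf

theorem measurable_sigma_mk (i : Fin n) : Measurable (Sigma.mk i : Y i → Σ i, Y i) :=
  fun _ h => measurableSet_sigma.1 h i

theorem measurableSet_sigma_image {i : Fin n} {S : Set (Y i)} (hS : MeasurableSet S) :
    MeasurableSet (Sigma.mk i '' S : Set (Σ i, Y i)) := by
  refine measurableSet_sigma.2 fun j => ?_
  rcases eq_or_ne i j with rfl | h
  · rwa [preimage_image_eq _ sigma_mk_injective]
  · rw [preimage_image_sigmaMk_of_ne h.symm]
    exact .empty

/-- The measure on a disjoint union which restricts on each summand to the pull-back of a measure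
under a given map. -/
noncomputable def sigmaPullback (q : (Σ i, Y i) → X) (μ : Measure X) : Measure (Σ i, Y i) :=
  Measure.sum fun i => (μ.comap fun y => q ⟨i, y⟩).map (Sigma.mk i)

variable {q : (Σ i, Y i) → X} {μ : Measure X}

theorem sigmaPullback_apply (hq : ∀ i, MeasurableEmbedding fun y => q ⟨i, y⟩) {S : Set (Σ i, Y i)}
    (hS : MeasurableSet S) :
    sigmaPullback q μ S = ∑ i, μ ((fun y => q ⟨i, y⟩) '' (Sigma.mk i ⁻¹' S)) := by
  rw [sigmaPullback, Measure.sum_apply _ hS, tsum_fintype]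
  refine Finset.sum_congr rfl fun i _ => ?_
  rw [Measure.map_apply (measurable_sigma_mk i) hS, (hq i).comap_apply]

theorem sigmaPullback_image (hq : ∀ i, MeasurableEmbedding fun y => q ⟨i, y⟩) {i : Fin n}
    {S : Set (Y i)} (hS : MeasurableSet S) :
    sigmaPullback q μ (Sigma.mk i '' S) = μ ((fun y => q ⟨i, y⟩) '' S) := by
  rw [sigmaPullback_apply hq (measurableSet_sigma_image hS), Finset.sum_eq_single i]
  · rw [preimage_image_eq _ sigma_mk_injective]
  · intro j _ h
    rw [preimage_image_sigmaMk_of_ne h, image_empty, measure_empty]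
  · simp

theorem isFiniteMeasure_sigmaPullback (hq : ∀ i, MeasurableEmbedding fun y => q ⟨i, y⟩)
    [IsFiniteMeasure μ] : IsFiniteMeasure (sigmaPullback q μ) := by
  refine ⟨?_⟩
  rw [sigmaPullback_apply hq .univ]
  exact ENNReal.sum_lt_top.2 fun i _ => measure_lt_top _ _

theorem quasiMeasurePreserving_sigmaPullback (hq : ∀ i, MeasurableEmbedding fun y => q ⟨i, y⟩) :
    Measure.QuasiMeasurePreserving q (sigmaPullback q μ) μ := by
  have hqm : Measurable q := fun S hS => measurableSet_sigma.2 fun i => (hq i).measurable hS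
  refine ⟨hqm, Measure.AbsolutelyContinuous.mk fun S hS h => ?_⟩
  rw [Measure.map_apply hqm hS, sigmaPullback_apply hq (hqm hS)]
  refine Finset.sum_eq_zero fun i _ => measure_mono_null ?_ h
  rintro _ ⟨y, hy, rfl⟩
  exact hy

/-- A surjection from a finite disjoint union which is a measurable embedding on each summand has a
measurable section: map a point to the first summand whose image contains it. -/
theorem exists_measurable_section (hq : ∀ i, MeasurableEmbedding fun y => q ⟨i, y⟩)
    (hs : Function.Surjective q) : ∃ σ : X → Σ i, Y i, Measurable σ ∧ ∀ x, q (σ x) = x := by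
  rcases isEmpty_or_nonempty X with hX | ⟨⟨x0⟩⟩
  · exact ⟨isEmptyElim, measurable_of_empty _, isEmptyElim⟩
  have hne : Nonempty (Σ i, Y i) := ⟨(hs x0).choose⟩
  have : Nonempty (Fin n) := ⟨(hs x0).choose.1⟩
  have h1 : ∀ i, ∃ g : X → Σ i, Y i, Measurable g ∧ g ∘ (fun y => q ⟨i, y⟩) = Sigma.mk i :=
    fun i => (hq i).exists_measurable_extend (measurable_sigma_mk i) fun _ => hne
  choose g hg hgq using h1
  set t : Fin n → Set X := fun i => range (fun y => q ⟨i, y⟩) \ ⋃ j < i, range fun y => q ⟨j, y⟩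
    with ht
  obtain ⟨σ, hσ, h2⟩ := exists_measurable_piecewise t
    (fun i => (hq i).measurableSet_range.diff
      (MeasurableSet.iUnion fun j => MeasurableSet.iUnion fun _ => (hq j).measurableSet_range))
    g hg (by
      have key : ∀ i j, i < j → ∀ x, x ∈ t i → x ∉ t j := fun i j h x hx hx' =>
        hx'.2 (mem_iUnion₂.2 ⟨i, h, hx.1⟩)
      intro i j h x hx
      rcases lt_or_gt_of_ne h with h | h
      · exact absurd hx.2 (key i j h x hx.1)
      · exact absurd hx.1 (key j i h x hx.2))
  refine ⟨σ, hσ, fun x => ?_⟩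
  classical
  obtain ⟨⟨i0, y0⟩, hx0⟩ := hs x
  obtain ⟨i, ⟨y, hy⟩, hmin⟩ := WellFounded.has_min (wellFounded_lt (α := Fin n))
    {i | x ∈ range fun y => q ⟨i, y⟩} ⟨i0, y0, hx0⟩
  have hx : x ∈ t i := ⟨⟨y, hy⟩, fun h => by
    obtain ⟨j, hj, h⟩ := mem_iUnion₂.1 h
    exact hmin j h hj⟩
  rw [h2 i hx, ← hy]
  exact congrArg q (congrFun (hgq i) y)

theorem quasiMeasurePreserving_section (hq : ∀ i, MeasurableEmbedding fun y => q ⟨i, y⟩)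
    {σ : X → Σ i, Y i} (hσ : Measurable σ) (hqσ : ∀ x, q (σ x) = x) :
    Measure.QuasiMeasurePreserving σ μ (sigmaPullback q μ) := by
  refine ⟨hσ, Measure.AbsolutelyContinuous.mk fun S hS h => ?_⟩
  rw [Measure.map_apply hσ hS]
  rw [sigmaPullback_apply hq hS, Finset.sum_eq_zero_iff] at h
  refine measure_mono_null (t := ⋃ i, (fun y => q ⟨i, y⟩) '' (Sigma.mk i ⁻¹' S)) ?_
    (measure_iUnion_null fun i => h i (Finset.mem_univ i))
  intro x hx
  exact mem_iUnion.2 ⟨(σ x).1, (σ x).2, hx, hqσ x⟩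

end SigmaPullback

/-! ### Passing from the transversal to its image -/

/-- The indicator function of a set, as a bounded function. -/
noncomputable def indicatorLp {T : Type*} (S : Set T) : lp (fun _ : T => ℝ) ⊤ :=
  ⟨S.indicator 1, memℓp_infty ⟨1, by
    rintro _ ⟨t, rfl⟩
    by_cases h : t ∈ S <;> simp [h]⟩⟩

theorem indicatorLp_apply {T : Type*} (S : Set T) (t : T) : indicatorLp S t = S.indicator 1 t := rfl

theorem norm_indicatorLp_le {T : Type*} (S : Set T) : ‖indicatorLp S‖ ≤ 1 :=
  lp.norm_le_of_forall_le zero_le_one fun t => by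
    rw [indicatorLp_apply]
    by_cases h : t ∈ S <;> simp [h]

section Transfer

variable {T X : Type*} [MeasurableSpace T] [MeasurableSpace X] {ν : Measure T} {μ : Measure X}
  {q : T → X} {σ : X → T} {r : Setoid T} {r' : Setoid X}

theorem Setoid.IsErgodicFor.of_section (h : r'.IsErgodicFor μ)
    (hq : Measure.QuasiMeasurePreserving q ν μ) (hσ : Measurable σ) (hqσ : ∀ x, q (σ x) = x)
    (hr : ∀ s t, r s t ↔ r' (q s) (q t)) : r.IsErgodicFor ν := by
  intro B hB hBs
  have h1 : B = q ⁻¹' (σ ⁻¹' B) := by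
    ext s
    have h2 : r s (σ (q s)) := (hr _ _).2 (by rw [hqσ])
    exact ⟨hBs _ _ h2, hBs _ _ (r.symm h2)⟩
  have h3 : ∀ x y, r' x y → x ∈ σ ⁻¹' B → y ∈ σ ⁻¹' B := fun x y hxy =>
    hBs _ _ ((hr _ _).2 (by rwa [hqσ, hqσ]))
  rcases h _ (hσ hB) h3 with h4 | h4
  · left
    rw [h1]
    exact hq.preimage_null h4
  · right
    rw [h1]
    exact hq.preimage_null h4

/-- The images under `q` of the means of an amenable relation, restricted to indicator functions. -/
theorem Setoid.IsAmenableFor.exists_isMeanSystem (h : r.IsAmenableFor ν) (hq : Measurable q)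
    (hσ : Measure.QuasiMeasurePreserving σ μ ν) (hqσ : ∀ x, q (σ x) = x)
    (hr : ∀ s t, r s t ↔ r' (q s) (q t)) : ∃ m, r'.IsMeanSystem μ m := by
  obtain ⟨m, hm, hmm⟩ := h
  refine ⟨fun x S => m (σ x) (indicatorLp (q ⁻¹' S)), ?_, fun E hE => ?_⟩
  · filter_upwards [hσ.ae hm] with x ⟨⟨hpos, hone, hsupp⟩, hinv⟩
    have huniv : indicatorLp (univ : Set T) = 1 := by
      ext t
      simp [indicatorLp_apply]
    refine ⟨fun S => hpos _ fun t => ?_, fun S S' hS => ?_, ?_, ?_, fun z hz => ?_⟩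
    · exact indicator_nonneg (fun _ _ => zero_le_one) t
    · rw [← map_add]
      congr 1
      ext t
      simp only [lp.coeFn_add, Pi.add_apply, indicatorLp_apply]
      rw [preimage_union, indicator_union_of_disjoint (hS.preimage q)]
    · rw [preimage_univ, huniv, hone]
    · have h1 : m (σ x) (1 - indicatorLp (q ⁻¹' {z | r' x z})) = 0 := by
        refine hsupp _ fun z hz => ?_
        have hz : z ∈ q ⁻¹' {z | r' x z} := by
          have := (hr _ _).1 hz
          rwa [hqσ] at this
        rw [← huniv]
        rw [lp.coeFn_sub, Pi.sub_apply, indicatorLp_apply, indicatorLp_apply, indicator_of_mem hz,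
          indicator_of_mem (mem_univ z), sub_self]
      rw [map_sub, hone] at h1
      linarith
    · have h1 := hinv (σ z) ((hr _ _).2 (by rwa [hqσ, hqσ]))
      funext S
      rw [h1]
  · have h1 := hmm (fun s => indicatorLp (q ⁻¹' {z | (q s, z) ∈ E})) (by
      have h2 : Measurable fun p : T × T => (q p.1, q p.2) := by fun_prop
      exact (measurable_const (a := (1 : ℝ))).indicator (h2 hE))
      ⟨1, fun s => norm_indicatorLp_le _⟩
    have h3 := h1.comp_quasiMeasurePreserving hσ
    refine h3.congr (.of_forall fun x => ?_)
    simp only [Function.comp_apply, hqσ]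

end Transfer

open Pants Pants.Suspension

/-! ### The transverse measure of the foliation -/

instance : T2Space (Pants.Suspension monodromy) :=
  t2Space IsSmoothMonodromy.lifts

theorem measurableEmbedding_toTorus_mk (i : Fin (regularAtlas monodromy).size) :
    MeasurableEmbedding fun y => toTorus monodromy ⟨i, y⟩ := by
  have : PolishSpace ((regularAtlas monodromy).LocalTransversal i) :=
    (isOpen_localTransversal monodromy i).polishSpace
  exact (continuous_toTorus_mk monodromy i).measurableEmbedding (injective_toTorus_mk monodromy i)

/-- The transverse measure given by the Haar measure of the torus. -/
noncomputable def transverseMeasure : Measure (regularAtlas monodromy).Transversal :=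
  sigmaPullback (toTorus monodromy) torusMeasure

theorem isInvariant_transverseMeasure :
    (regularAtlas monodromy).IsInvariant transverseMeasure := by
  intro i j B hB hdom
  obtain ⟨H, hH, hHq⟩ := exists_adj_holonomy monodromy i j
  have hHm : MeasurePreserving H torusMeasure torusMeasure := by
    rcases hH with rfl | ⟨ε, k, rfl⟩
    · exact MeasurePreserving.id _
    · exact measurePreserving_holonomy ε k
  set C := {z | ∃ y ∈ B, (regularAtlas monodromy).Adj ⟨i, y⟩ ⟨j, z⟩} with hC
  have h1 : (fun z => toTorus monodromy ⟨j, z⟩) '' C =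
      H '' ((fun y => toTorus monodromy ⟨i, y⟩) '' B) := by
    ext x
    constructor
    · rintro ⟨z, ⟨y, hy, hyz⟩, rfl⟩
      exact ⟨_, ⟨y, hy, rfl⟩, (hHq y z hyz).symm⟩
    · rintro ⟨_, ⟨y, hy, rfl⟩, rfl⟩
      obtain ⟨z, hz⟩ := hdom y hy
      exact ⟨z, ⟨y, hy, hz⟩, hHq y z hz⟩
  have h2 := (measurableEmbedding_toTorus_mk i).measurableSet_image.2 hB
  have h3 := H.measurableEmbedding.measurableSet_image.2 h2
  have hCm : MeasurableSet C := by
    rw [← (measurableEmbedding_toTorus_mk j).measurableSet_image, h1]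
    exact h3
  rw [transverseMeasure, sigmaPullback_image measurableEmbedding_toTorus_mk hCm,
    sigmaPullback_image measurableEmbedding_toTorus_mk hB, h1,
    ← hHm.measure_preimage h3.nullMeasurableSet, preimage_image_eq _ H.injective]

/-! ### The Følner property -/

theorem finite_toTorus_preimage (x : Torus) : (toTorus monodromy ⁻¹' {x}).Finite := by
  have h : toTorus monodromy ⁻¹' {x} =
      ⋃ i, Sigma.mk i '' ((fun y => toTorus monodromy ⟨i, y⟩) ⁻¹' {x}) := by
    ext ⟨i, y⟩
    simp only [mem_iUnion]
    refine ⟨fun hy => ⟨i, y, hy, rfl⟩, ?_⟩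
    rintro ⟨j, z, hz, h⟩
    rw [← h]
    exact hz
  rw [h]
  refine finite_iUnion fun i => Finite.image _ ?_
  exact (finite_singleton x).preimage (injective_toTorus_mk monodromy i).injOn

theorem ncard_toTorus_preimage_le (x : Torus) :
    (toTorus monodromy ⁻¹' {x}).ncard ≤ (regularAtlas monodromy).size := by
  have h : InjOn Sigma.fst (toTorus monodromy ⁻¹' {x}) := by
    rintro ⟨i, y⟩ hy ⟨i', y'⟩ hy' (rfl : i = i')
    rw [injective_toTorus_mk monodromy i (Eq.trans hy (Eq.symm hy'))]
  rw [← h.ncard_image]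
  refine (ncard_le_ncard (subset_univ _)).trans ?_
  rw [ncard_univ, Nat.card_eq_fintype_card, Fintype.card_fin]

/-- The points of the transversal over the first `N` points of an orbit of the hyperbolic
automorphism. -/
def orbitSegment (N : ℕ) (x : Torus) : Set (regularAtlas monodromy).Transversal :=
  ⋃ i ∈ Finset.range N, toTorus monodromy ⁻¹' {hyperbolic^[i] x}

theorem finite_orbitSegment (N : ℕ) (x : Torus) : (orbitSegment N x).Finite :=
  (Finset.range N).finite_toSet.biUnion fun _ _ => finite_toTorus_preimage _

theorem mem_orbitSegment {N : ℕ} {x : Torus} {s : (regularAtlas monodromy).Transversal} :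
    s ∈ orbitSegment N x ↔ ∃ i < N, toTorus monodromy s = hyperbolic^[i] x := by
  simp [orbitSegment]

theorem le_card_orbitSegment {N : ℕ} {x : Torus} (hx : x ∈ quietSet N) :
    N ≤ (finite_orbitSegment N x).toFinset.card := by
  classical
  have h : (Finset.range N).image (fun i => hyperbolic^[i] x) ⊆
      (finite_orbitSegment N x).toFinset.image (toTorus monodromy) := by
    intro y hy
    obtain ⟨i, hi, rfl⟩ := Finset.mem_image.1 hy
    obtain ⟨s, hs⟩ := surjective_toTorus monodromy (hyperbolic^[i] x)
    exact Finset.mem_image.2 ⟨s, (finite_orbitSegment N x).mem_toFinset.2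
      (mem_orbitSegment.2 ⟨i, Finset.mem_range.1 hi, hs⟩), hs⟩
  have h1 := (Finset.card_le_card h).trans Finset.card_image_le
  rwa [Finset.card_image_of_injective _ hx.2, Finset.card_range] at h1

/-- The boundary of an orbit segment in the strip lies over its two end points. -/
theorem ncard_graphBoundary_orbitSegment_le {N : ℕ} {x : Torus} (hx : x ∈ quietSet N) :
    (graphBoundary (regularAtlas monodromy).Adj (finite_orbitSegment N x).toFinset).ncard ≤
      2 * (regularAtlas monodromy).size := by
  have h : graphBoundary (regularAtlas monodromy).Adj (finite_orbitSegment N x).toFinset ⊆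
      toTorus monodromy ⁻¹' {x} ∪ toTorus monodromy ⁻¹' {hyperbolic^[N - 1] x} := by
    rintro s ⟨hs, t, ht, hst⟩
    rw [Finite.mem_toFinset, mem_orbitSegment] at hs ht
    obtain ⟨i, hi, hs⟩ := hs
    by_contra hn
    simp only [mem_union, mem_preimage, mem_singleton_iff, not_or, hs] at hn
    have h0 : i ≠ 0 := by
      rintro rfl
      exact hn.1 rfl
    have h1 : i + 1 < N := by
      by_contra h1
      exact hn.2 (by rw [show i = N - 1 by omega])
    obtain ⟨H, hH, hHq⟩ := exists_adj_holonomy monodromy s.1 t.1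
    obtain ⟨k, hk, hkH⟩ := holonomy_mem_segment hx h0 h1 hH
    exact ht ⟨k, hk, by rw [← hkH, ← hs]; exact hHq s.2 t.2 hst⟩
  refine (ncard_le_ncard h ((finite_toTorus_preimage _).union (finite_toTorus_preimage _))).trans ?_
  refine (ncard_union_le _ _).trans ?_
  have h1 := ncard_toTorus_preimage_le x
  have h2 := ncard_toTorus_preimage_le (hyperbolic^[N - 1] x)
  omega

theorem orbitSetoid_iterate (x : Torus) (i : ℕ) :
    orbitSetoid monodromy x (hyperbolic^[i] x) := by
  induction i with
  | zero => exact (orbitSetoid monodromy).refl x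
  | succ i ih =>
    rw [Function.iterate_succ_apply']
    exact (orbitSetoid monodromy).trans ih (orbitSetoid_apply monodromy 2 _)

theorem isFolner_transverseMeasure : (regularAtlas monodromy).IsFolner transverseMeasure := by
  have hq := quasiMeasurePreserving_sigmaPullback (μ := torusMeasure) measurableEmbedding_toTorus_mk
  filter_upwards [hq.ae (ae_all_iff.2 ae_exists_mem_quietSet)] with s hs
  choose x hsx hx using fun k : ℕ => hs (k + 1)
  have hcard : ∀ k, k + 1 ≤ (finite_orbitSegment (k + 1) (x k)).toFinset.card :=
    fun k => le_card_orbitSegment (hx k)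
  refine ⟨fun k => (finite_orbitSegment (k + 1) (x k)).toFinset, fun k => ⟨?_, fun t ht => ?_⟩, ?_⟩
  · exact Finset.card_pos.1 (k.succ_pos.trans_le (hcard k))
  · rw [Finite.mem_toFinset, mem_orbitSegment] at ht
    obtain ⟨i, -, ht⟩ := ht
    refine (rel_iff monodromy rfl s t).2 ?_
    rw [ht]
    exact (orbitSetoid monodromy).trans (hsx k) (orbitSetoid_iterate _ _)
  · have h0 := (tendsto_one_div_add_atTop_nhds_zero_nat (𝕜 := ℝ)).const_mul
      ((2 * (regularAtlas monodromy).size : ℕ) : ℝ)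
    rw [mul_zero] at h0
    refine squeeze_zero (fun k => by positivity) (fun k => ?_) h0
    rw [mul_one_div]
    have h1 : ((k : ℝ) + 1) ≤ ((finite_orbitSegment (k + 1) (x k)).toFinset.card : ℝ) := by
      exact_mod_cast hcard k
    exact div_le_div₀ (Nat.cast_nonneg _)
      (Nat.cast_le.2 (ncard_graphBoundary_orbitSegment_le (hx k))) (by positivity) h1

/-! ### The example -/

theorem proposition3p2 :
    ∃ (M : Type) (_ : TopologicalSpace M) (_ : ChartedSpace (EuclideanSpace ℝ (Fin 4)) M),
      IsManifold (𝓡 4) ∞ M ∧ T2Space M ∧ CompactSpace M ∧ ConnectedSpace M ∧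
      ∃ (F : Foliation M 4 2 2) (A : F.RegularAtlas) (ν : Measure A.Transversal),
        IsFiniteMeasure ν ∧ A.IsInvariant ν ∧ A.IsErgodic ν ∧
        A.IsFolner ν ∧ ¬ A.IsAmenable ν := by
  have hr := rel_iff monodromy rfl
  have hq := quasiMeasurePreserving_sigmaPullback (μ := torusMeasure) measurableEmbedding_toTorus_mk
  obtain ⟨σ, hσ, hqσ⟩ :=
    exists_measurable_section measurableEmbedding_toTorus_mk (surjective_toTorus monodromy)
  have hσq := quasiMeasurePreserving_section (μ := torusMeasure) measurableEmbedding_toTorus_mk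
    hσ hqσ
  refine ⟨Pants.Suspension monodromy, inferInstance, inferInstance, inferInstance, inferInstance,
    compactSpace, connectedSpace, foliation monodromy, regularAtlas monodromy, transverseMeasure,
    isFiniteMeasure_sigmaPullback measurableEmbedding_toTorus_mk, isInvariant_transverseMeasure,
    ?_, isFolner_transverseMeasure, fun h => ?_⟩
  · exact Setoid.IsErgodicFor.of_section (fun _ => ergodic_orbitSetoid) hq hσ hqσ hr
  · obtain ⟨m, hm⟩ := Setoid.IsAmenableFor.exists_isMeanSystem h hq.measurable hσq hqσ hr
    exact not_isMeanSystem m hm
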